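/- Theorem (excision for the homology digraph). Fix a field $\mathbb{K}$; homology is singular homology with coefficients in $\mathbb{K}$, graded by $\mathbb{Z}$. A relation on a graded vector space $V$ is a relation on $\coprod_k V_k$. It is called bilinear if there is a graded vector subspace $R \subseteq V \otimes V$ such that homogeneous elements $v, w$ are related if and only if $v \otimes w \in R$. A directional graded vector space is a graded vector space $V$ with a bilinear relation $\searrow_V$, and a morphism of directional graded vector spaces is a morphism of graded vector spaces $f \colon V \to W$ such that $v \searrow_V w$ implies $f(v) \searrow_W f(w)$. For a preordered space $X$ (a topological space with a preorder $\preceq_X$) and a preordered subspace $A \subseteq X$ (a subspace with the induced preorder), the homology digraph of $(X,A)$ is the directional graded vector space $H_*(X,A)$ whose relation is the smallest bilinear relation containing the following relation $\nearrow$: $\alpha \nearrow \beta$ if there exist subspaces $E, F \subseteq X$ such that $\alpha \in \operatorname{im} H_*((E, E\cap A) \hookrightarrow (X,A))$, $\beta \in \operatorname{im} H_*((F, F\cap A) \hookrightarrow (X,A))$, and $x \preceq_X y$ for all $x \in E$ and $y \in F$. Let $X$ be a preordered space, let $A$ be a preordered subspace of $X$, and let $U$ be a subset of $A$ such that $\overline{U}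 \subseteq \operatorname{int}(A)$ (closure and interior in $X$). Then the map $H_*(X\setminus U, A\setminus U) \to H_*(X,A)$ induced by the inclusion is an isomorphism of directional graded vector spaces, where $X \setminus U$ and $A \setminus U$ carry the subspace topology and the induced preorder. -/

import Mathlib

open CategoryTheory CategoryTheory.Limits
open scoped TensorProduct DirectSum

universe u v w

/-! ### Graded vector spaces, bilinear relations, directional graded vector spaces -/

section Directional

variable {K : Type v} [Field K]

/-- A relation on a `ℤ`-graded vector space `V` is a relation on the disjoint union of its
homogeneous components. -/
abbrev GradedRel (V : ℤ → ModuleCat.{w} K) : Type w :=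
  (Σ k, V k) → (Σ k, V k) → Prop

/-- The degree `n` component `⨁_{i + j = n} V i ⊗ V j` of the graded vector space `V ⊗ V`. -/
abbrev tensorSquare (V : ℤ → ModuleCat.{w} K) (n : ℤ) : Type w :=
  ⨁ p : {p : ℤ × ℤ // p.1 + p.2 = n}, (V p.1.1 ⊗[K] V p.1.2)

/-- For homogeneous elements `v ∈ V i` and `w ∈ V j`, the element `v ⊗ w ∈ (V ⊗ V)_{i + j}`. -/
noncomputable def homogeneousTmul (V : ℤ → ModuleCat.{w} K) {i j : ℤ} (x : V i) (y : V j) :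
    tensorSquare V (i + j) :=
  DirectSum.lof K {p : ℤ × ℤ // p.1 + p.2 = i + j} (fun p => V p.1.1 ⊗[K] V p.1.2)
    ⟨(i, j), rfl⟩ (x ⊗ₜ[K] y)

/-- The graded vector subspace `R ⊆ V ⊗ V` is a defining vector space for the relation `r`. -/
def IsDefiningSpace {V : ℤ → ModuleCat.{w} K} (r : GradedRel V)
    (R : ∀ n : ℤ, Submodule K (tensorSquare V n)) : Prop :=
  ∀ (i j : ℤ) (x : V i) (y : V j), r ⟨i, x⟩ ⟨j, y⟩ ↔ homogeneousTmul V x y ∈ R (i + j)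

/-- A relation is bilinear if it has a defining vector space. -/
def IsBilinearRel {V : ℤ → ModuleCat.{w} K} (r : GradedRel V) : Prop :=
  ∃ R : ∀ n : ℤ, Submodule K (tensorSquare V n), IsDefiningSpace r R

/-- The bilinear relation generated by `r`: the intersection of all bilinear relations
containing `r`. -/
def generatedRel {V : ℤ → ModuleCat.{w} K} (r : GradedRel V) : GradedRel V :=
  fun a b => ∀ s : GradedRel V, IsBilinearRel s → (∀ c d, r c d → s c d) → s a b

theorem isBilinearRel_generatedRel {V : ℤ → ModuleCat.{w} K} (r : GradedRel V) :
    IsBilinearRel (generatedRel r) := by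
  refine ⟨fun n => sInf {S | ∃ (s : GradedRel V) (R : ∀ n : ℤ, Submodule K (tensorSquare V n)),
    IsDefiningSpace s R ∧ (∀ c d, r c d → s c d) ∧ S = R n}, fun i j x y => ?_⟩
  rw [Submodule.mem_sInf]
  constructor
  · rintro h _ ⟨s, R, hR, hs, rfl⟩
    exact (hR i j x y).1 (h s ⟨R, hR⟩ hs)
  · rintro h s ⟨R, hR⟩ hs
    exact (hR i j x y).2 (h _ ⟨s, R, hR, hs, rfl⟩)

theorem le_generatedRel {V : ℤ → ModuleCat.{w} K} (r : GradedRel V) (a b : Σ k, V k)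
    (h : r a b) : generatedRel r a b :=
  fun _ _ hs => hs a b h

theorem generatedRel_le {V : ℤ → ModuleCat.{w} K} {r s : GradedRel V} (hs : IsBilinearRel s)
    (h : ∀ c d, r c d → s c d) (a b : Σ k, V k) (hab : generatedRel r a b) : s a b :=
  hab s hs h

variable (K) in
/-- A directional graded vector space: a `ℤ`-graded vector space with a bilinear relation, its
pointing relation. -/
structure DirGrVect where
  /-- the homogeneous components -/
  obj : ℤ → ModuleCat.{w} K
  /-- the pointing relation -/
  pointsTo : GradedRel obj
  isBilinear : IsBilinearRel pointsTo

namespace DirGrVect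

/-- A morphism of directional graded vector spaces: a morphism of graded vector spaces that is
compatible with the pointing relations. -/
@[ext]
structure Hom (V W : DirGrVect.{v, w} K) where
  /-- the homogeneous components -/
  app : ∀ k : ℤ, V.obj k ⟶ W.obj k
  map_pointsTo : ∀ (i j : ℤ) (x : V.obj i) (y : V.obj j),
    V.pointsTo ⟨i, x⟩ ⟨j, y⟩ → W.pointsTo ⟨i, app i x⟩ ⟨j, app j y⟩

/-- The category of directional graded vector spaces. -/
instance : Category (DirGrVect.{v, w} K) where
  Hom := Hom
  id V := ⟨fun _ => 𝟙 _, fun _ _ _ _ h => h⟩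
  comp f g := ⟨fun k => f.app k ≫ g.app k,
    fun i j _ _ h => g.map_pointsTo i j _ _ (f.map_pointsTo i j _ _ h)⟩

end DirGrVect

end Directional

/-! ### Relative singular homology -/

section Homology

variable (K : Type v) [Field K]

/-- The singular chain complex functor with coefficients in the field `K`. -/
noncomputable abbrev singChains : TopCat.{u} ⥤ ChainComplex (ModuleCat.{max u v} K) ℕ :=
  (AlgebraicTopology.singularChainComplexFunctor (ModuleCat.{max u v} K)).obj
    (ModuleCat.of K (ULift.{u} K))

/-- The relative singular chain complex functor: a topological pair `(X, A)` is sent to the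
quotient of the singular chains of `X` by the singular chains of `A`. -/
noncomputable def relSingChains : TopPair.{u} ⥤ ChainComplex (ModuleCat.{max u v} K) ℕ :=
  MorphismProperty.Arrow.forget _ _ _ ⋙ (singChains.{u, v} K).mapArrow ⋙ coker _

/-- Relative singular homology with coefficients in the field `K` as a family of functors indexed
by `ℤ`; it vanishes in negative degrees. -/
noncomputable def relHomology : ℤ → (TopPair.{u} ⥤ ModuleCat.{max u v} K)
  | Int.ofNat n => relSingChains K ⋙ HomologicalComplex.homologyFunctor _ _ n
  | Int.negSucc _ => (Functor.const _).obj (ModuleCat.of K PUnit)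

end Homology

/-! ### The homology digraph -/

section Digraph

/-- The pair `(X, A)` of topological spaces. -/
abbrev topPair {X : Type u} [TopologicalSpace X] (A : Set X) : TopPair.{u} :=
  TopPair.ofSubset (X := TopCat.of X) A

/-- The map of pairs `(S, T) → (X, A)` given by the inclusion of a subspace `S` of `X`, where `T`
is a subset of `S` that is contained in `A`. -/
def inclPair {X : Type u} [TopologicalSpace X] (A S : Set X) (T : Set S)
    (h : Set.MapsTo Subtype.val T A) : topPair T ⟶ topPair A :=
  TopPair.ofHom (TopCat.ofHom ⟨Subtype.val, continuous_subtype_val⟩)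
    (TopCat.ofHom ⟨h.restrict, (continuous_subtype_val.restrict h)⟩) rfl

variable (K : Type v) [Field K] {X : Type u} [TopologicalSpace X]

/-- `α ∈ im H_k ((E, E ∩ A) ↪ (X, A))`. -/
def IsSupportedIn (A E : Set X) {k : ℤ} (α : (relHomology.{u, v} K k).obj (topPair A)) : Prop :=
  ∃ γ, (relHomology.{u, v} K k).map
    (inclPair A E (Subtype.val ⁻¹' A) (Set.mapsTo_preimage _ _)) γ = α

variable [Preorder X]

/-- The relation on `H_*(X, A)` that generates the pointing relation. -/
def generatingRel (A : Set X) : GradedRel fun k => (relHomology.{u, v} K k).obj (topPair A) :=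
  fun α β => ∃ E F : Set X, IsSupportedIn K A E α.2 ∧ IsSupportedIn K A F β.2 ∧
    ∀ x ∈ E, ∀ y ∈ F, x ≤ y

/-- The homology digraph of the pair `(X, A)`, where `X` is a preordered space and `A` is a
preordered subspace. -/
noncomputable def homologyDigraph (A : Set X) : DirGrVect.{v, max u v} K where
  obj k := (relHomology.{u, v} K k).obj (topPair A)
  pointsTo := generatedRel (generatingRel K A)
  isBilinear := isBilinearRel_generatedRel _

end Digraph

/-! ### Chains of tuples -/

section TupleChains

variable (K : Type v) [Field K] {V W : Type*}

/-- The boundary of formal linear combinations of tuples: the alternating sum over the omission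
of one entry. Tuples of length `m` play the role of affine simplices of dimension `m - 1`, so that
the complex is augmented by the empty tuple. -/
noncomputable def tupleBoundary (V : Type*) (m : ℕ) :
    ((Fin (m + 1) → V) →₀ K) →ₗ[K] ((Fin m → V) →₀ K) :=
  Finsupp.linearCombination K fun v =>
    ∑ i : Fin (m + 1), Finsupp.single (v ∘ i.succAbove) ((-1 : K) ^ (i : ℕ))

/-- The cone with apex `p`. -/
noncomputable def tupleCone (p : V) (m : ℕ) :
    ((Fin m → V) →₀ K) →ₗ[K] ((Fin (m + 1) → V) →₀ K) :=
  Finsupp.lmapDomain K K (Fin.cons (α := fun _ => V) p)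

/-- The map on chains of tuples induced by a map on entries. -/
noncomputable def tupleMap (f : V → W) (m : ℕ) :
    ((Fin m → V) →₀ K) →ₗ[K] ((Fin m → W) →₀ K) :=
  Finsupp.lmapDomain K K (f ∘ ·)

variable {K}

@[simp]
lemma tupleBoundary_single (m : ℕ) (v : Fin (m + 1) → V) (a : K) :
    tupleBoundary K V m (Finsupp.single v a) =
      a • ∑ i : Fin (m + 1), Finsupp.single (v ∘ i.succAbove) ((-1 : K) ^ (i : ℕ)) := by
  simp [tupleBoundary]

@[simp]
lemma tupleCone_single (p : V) (m : ℕ) (v : Fin m → V) (a : K) :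
    tupleCone K p m (Finsupp.single v a) =
      Finsupp.single (Fin.cons (α := fun _ => V) p v) a := by
  simp [tupleCone]

@[simp]
lemma tupleMap_single (f : V → W) (m : ℕ) (v : Fin m → V) (a : K) :
    tupleMap K f m (Finsupp.single v a) = Finsupp.single (f ∘ v) a := by
  simp [tupleMap]

lemma finCons_comp_succAbove_succ (p : V) {m : ℕ} (v : Fin (m + 1) → V) (j : Fin (m + 1)) :
    Fin.cons (α := fun _ => V) p v ∘ j.succ.succAbove =
      Fin.cons (α := fun _ => V) p (v ∘ j.succAbove) := by
  ext i
  refine Fin.cases ?_ (fun i => ?_) i <;> simp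

lemma tupleBoundary_tupleCone (p : V) (m : ℕ) (c : (Fin (m + 1) → V) →₀ K) :
    tupleBoundary K V (m + 1) (tupleCone K p (m + 1) c) =
      c - tupleCone K p m (tupleBoundary K V m c) := by
  induction c using Finsupp.induction_linear with
  | zero => simp
  | add c d hc hd => simp only [map_add, hc, hd]; abel
  | single v a =>
    have h0 : Fin.cons (α := fun _ => V) p v ∘ Fin.succ = v := by ext i; simp
    rw [tupleCone_single, tupleBoundary_single, Fin.sum_univ_succ, tupleBoundary_single, map_smul,
      map_sum, smul_add, sub_eq_add_neg]
    congr 1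
    · simp [h0]
    · rw [← smul_neg, ← Finset.sum_neg_distrib]
      congr 1
      refine Finset.sum_congr rfl fun j _ => ?_
      rw [finCons_comp_succAbove_succ, tupleCone_single, ← Finsupp.single_neg, Fin.val_succ,
        pow_succ, mul_neg_one]

lemma tupleBoundary_tupleCone_zero (p : V) (c : (Fin 0 → V) →₀ K) :
    tupleBoundary K V 0 (tupleCone K p 0 c) = c := by
  induction c using Finsupp.induction_linear with
  | zero => simp
  | add c d hc hd => simp only [map_add, hc, hd]
  | single v a => simp [Subsingleton.elim _ v]

lemma tupleBoundary_tupleBoundary (m : ℕ) (c : (Fin (m + 2) → V) →₀ K) :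
    tupleBoundary K V m (tupleBoundary K V (m + 1) c) = 0 := by
  induction m with
  | zero =>
    induction c using Finsupp.induction_linear with
    | zero => simp
    | add c d hc hd => simp only [map_add, hc, hd, add_zero]
    | single v a =>
      rw [← Fin.cons_self_tail v, ← tupleCone_single, tupleBoundary_tupleCone, map_sub,
        tupleBoundary_tupleCone_zero, sub_self]
  | succ m ih =>
    induction c using Finsupp.induction_linear with
    | zero => simp
    | add c d hc hd => simp only [map_add, hc, hd, add_zero]
    | single v a =>
      rw [← Fin.cons_self_tail v, ← tupleCone_single, tupleBoundary_tupleCone, map_sub,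
        tupleBoundary_tupleCone, ih, map_zero, sub_zero, sub_self]

lemma tupleMap_tupleBoundary (f : V → W) (m : ℕ) (c : (Fin (m + 1) → V) →₀ K) :
    tupleMap K f m (tupleBoundary K V m c) = tupleBoundary K W m (tupleMap K f (m + 1) c) := by
  induction c using Finsupp.induction_linear with
  | zero => simp
  | add c d hc hd => simp only [map_add, hc, hd]
  | single v a => simp [Function.comp_assoc]

lemma tupleMap_tupleCone (f : V → W) (p : V) (m : ℕ) (c : (Fin m → V) →₀ K) :
    tupleMap K f (m + 1) (tupleCone K p m c) = tupleCone K (f p) m (tupleMap K f m c) := by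
  induction c using Finsupp.induction_linear with
  | zero => simp
  | add c d hc hd => simp only [map_add, hc, hd]
  | single v a => simp [Fin.comp_cons]

variable (b : ∀ m : ℕ, (Fin (m + 1) → V) → V) (b' : ∀ m : ℕ, (Fin (m + 1) → W) → W)

/-- The subdivision of chains of tuples, for a choice `b` of an apex for each tuple. -/
noncomputable def tupleSd : ∀ m : ℕ, ((Fin m → V) →₀ K) →ₗ[K] ((Fin m → V) →₀ K)
  | 0 => LinearMap.id
  | m + 1 => Finsupp.linearCombination K fun v =>
      tupleCone K (b m v) m (tupleSd m (tupleBoundary K V m (Finsupp.single v 1)))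

/-- The chain homotopy between the identity and the subdivision. -/
noncomputable def tupleSdHomotopy : ∀ m : ℕ, ((Fin m → V) →₀ K) →ₗ[K] ((Fin (m + 1) → V) →₀ K)
  | 0 => 0
  | m + 1 => Finsupp.linearCombination K fun v => tupleCone K (b m v) (m + 1)
      (Finsupp.single v 1 - tupleSdHomotopy m (tupleBoundary K V m (Finsupp.single v 1)))

lemma tupleSd_zero (c : (Fin 0 → V) →₀ K) : tupleSd b 0 c = c := rfl

lemma tupleSdHomotopy_zero (c : (Fin 0 → V) →₀ K) : tupleSdHomotopy b 0 c = 0 := rfl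

lemma tupleSd_single (m : ℕ) (v : Fin (m + 1) → V) :
    tupleSd b (m + 1) (Finsupp.single v (1 : K)) =
      tupleCone K (b m v) m (tupleSd b m (tupleBoundary K V m (Finsupp.single v 1))) := by
  simp [tupleSd]

lemma tupleSdHomotopy_single (m : ℕ) (v : Fin (m + 1) → V) :
    tupleSdHomotopy b (m + 1) (Finsupp.single v (1 : K)) = tupleCone K (b m v) (m + 1)
      (Finsupp.single v 1 - tupleSdHomotopy b m (tupleBoundary K V m (Finsupp.single v 1))) := by
  simp [tupleSdHomotopy]

/-- Two linear maps on chains agree if they agree on generators. -/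
lemma finsupp_linearMap_congr {α M : Type*} [AddCommGroup M] [Module K M] {f g : (α →₀ K) →ₗ[K] M}
    (h : ∀ a, f (Finsupp.single a 1) = g (Finsupp.single a 1)) (c : α →₀ K) : f c = g c := by
  have : f = g := by ext a; exact h a
  rw [this]

lemma tupleBoundary_tupleSd (m : ℕ) (c : (Fin (m + 1) → V) →₀ K) :
    tupleBoundary K V m (tupleSd b (m + 1) c) = tupleSd b m (tupleBoundary K V m c) := by
  induction m with
  | zero =>
    refine finsupp_linearMap_congr (f := tupleBoundary K V 0 ∘ₗ tupleSd b 1)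
      (g := tupleSd b 0 ∘ₗ tupleBoundary K V 0) (fun v => ?_) c
    rw [LinearMap.comp_apply, LinearMap.comp_apply, tupleSd_single, tupleBoundary_tupleCone_zero]
  | succ m ih =>
    refine finsupp_linearMap_congr (f := tupleBoundary K V (m + 1) ∘ₗ tupleSd b (m + 2))
      (g := tupleSd b (m + 1) ∘ₗ tupleBoundary K V (m + 1)) (fun v => ?_) c
    rw [LinearMap.comp_apply, LinearMap.comp_apply, tupleSd_single, tupleBoundary_tupleCone, ih,
      tupleBoundary_tupleBoundary, map_zero, map_zero, sub_zero]

lemma tupleBoundary_tupleSdHomotopy (m : ℕ) (c : (Fin (m + 1) → V) →₀ K) :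
    tupleBoundary K V (m + 1) (tupleSdHomotopy b (m + 1) c) =
      c - tupleSd b (m + 1) c - tupleSdHomotopy b m (tupleBoundary K V m c) := by
  induction m with
  | zero =>
    refine finsupp_linearMap_congr (f := tupleBoundary K V 1 ∘ₗ tupleSdHomotopy b 1)
      (g := LinearMap.id - tupleSd b 1 - tupleSdHomotopy b 0 ∘ₗ tupleBoundary K V 0)
      (fun v => ?_) c
    simp only [LinearMap.comp_apply, LinearMap.sub_apply, LinearMap.id_apply]
    rw [tupleSdHomotopy_single, tupleBoundary_tupleCone, tupleSd_single, tupleSdHomotopy_zero,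
      sub_zero, sub_zero, tupleSd_zero]
  | succ m ih =>
    refine finsupp_linearMap_congr (f := tupleBoundary K V (m + 2) ∘ₗ tupleSdHomotopy b (m + 2))
      (g := LinearMap.id - tupleSd b (m + 2) -
        tupleSdHomotopy b (m + 1) ∘ₗ tupleBoundary K V (m + 1))
      (fun v => ?_) c
    simp only [LinearMap.comp_apply, LinearMap.sub_apply, LinearMap.id_apply]
    rw [tupleSdHomotopy_single, tupleBoundary_tupleCone, tupleSd_single, map_sub, ih,
      tupleBoundary_tupleBoundary, map_zero, sub_zero, sub_sub_cancel]
    abel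

variable {b b'}

lemma tupleMap_tupleSd {f : V → W} (hf : ∀ m v, f (b m v) = b' m (f ∘ v)) (m : ℕ)
    (c : (Fin m → V) →₀ K) :
    tupleMap K f m (tupleSd b m c) = tupleSd b' m (tupleMap K f m c) := by
  induction m with
  | zero => rfl
  | succ m ih =>
    refine finsupp_linearMap_congr (f := tupleMap K f (m + 1) ∘ₗ tupleSd b (m + 1))
      (g := tupleSd b' (m + 1) ∘ₗ tupleMap K f (m + 1)) (fun v => ?_) c
    rw [LinearMap.comp_apply, LinearMap.comp_apply, tupleSd_single, tupleMap_tupleCone, ih,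
      tupleMap_tupleBoundary, tupleMap_single, tupleSd_single, hf]

lemma tupleMap_tupleSdHomotopy {f : V → W} (hf : ∀ m v, f (b m v) = b' m (f ∘ v)) (m : ℕ)
    (c : (Fin m → V) →₀ K) :
    tupleMap K f (m + 1) (tupleSdHomotopy b m c) =
      tupleSdHomotopy b' m (tupleMap K f m c) := by
  induction m with
  | zero => simp [tupleSdHomotopy_zero]
  | succ m ih =>
    refine finsupp_linearMap_congr (f := tupleMap K f (m + 2) ∘ₗ tupleSdHomotopy b (m + 1))
      (g := tupleSdHomotopy b' (m + 1) ∘ₗ tupleMap K f (m + 1)) (fun v => ?_) c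
    rw [LinearMap.comp_apply, LinearMap.comp_apply, tupleSdHomotopy_single, tupleMap_tupleCone,
      map_sub, ih, tupleMap_tupleBoundary, tupleMap_single, tupleSdHomotopy_single, hf]

end TupleChains

lemma map_mem_of_mem_supported {K : Type*} [Field K] {α M : Type*} [AddCommGroup M] [Module K M]
    (f : (α →₀ K) →ₗ[K] M) {s : Set α} {N : Submodule K M}
    (h : ∀ a ∈ s, f (Finsupp.single a 1) ∈ N) {c : α →₀ K} (hc : c ∈ Finsupp.supported K K s) :
    f c ∈ N := by
  rw [Finsupp.supported_eq_span_single] at hc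
  refine (Submodule.span_le (p := N.comap f)).2 ?_ hc
  rintro _ ⟨a, ha, rfl⟩
  exact h a ha

/-! ### Affine simplices in a standard simplex and the mesh of their subdivision -/

section AffineSimplices

variable {ι : Type*} [Fintype ι]

/-- The affine map from a standard simplex to a standard simplex with prescribed vertices. -/
noncomputable def affineSimplex {m : ℕ} (v : Fin m → stdSimplex ℝ ι) :
    C(stdSimplex ℝ (Fin m), stdSimplex ℝ ι) where
  toFun t := ⟨∑ i, t i • (v i : ι → ℝ), (convex_stdSimplex ℝ ι).sum_mem (fun i _ => t.2.1 i)
    t.2.2 fun i _ => (v i).2⟩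
  continuous_toFun := by
    refine Continuous.subtype_mk (continuous_finsetSum _ fun i _ => ?_) _
    exact ((continuous_apply i).comp continuous_subtype_val).smul continuous_const

lemma affineSimplex_coe {m : ℕ} (v : Fin m → stdSimplex ℝ ι) (t : stdSimplex ℝ (Fin m)) :
    (affineSimplex v t : ι → ℝ) = ∑ i, t i • (v i : ι → ℝ) := rfl

lemma affineSimplex_apply {m : ℕ} (v : Fin m → stdSimplex ℝ ι) (t : stdSimplex ℝ (Fin m)) (j : ι) :
    affineSimplex v t j = ∑ i, t i * v i j := by
  rw [affineSimplex_coe, Finset.sum_apply]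
  rfl

lemma affineSimplex_affineSimplex {m n : ℕ} (v : Fin m → stdSimplex ℝ ι)
    (w : Fin n → stdSimplex ℝ (Fin m)) (t : stdSimplex ℝ (Fin n)) :
    affineSimplex v (affineSimplex w t) = affineSimplex (affineSimplex v ∘ w) t := by
  refine DFunLike.ext _ _ fun j => ?_
  simp only [affineSimplex_apply, Function.comp_apply, Finset.sum_mul, Finset.mul_sum, mul_assoc]
  exact Finset.sum_comm

lemma affineSimplex_vertex {m : ℕ} (v : Fin m → stdSimplex ℝ ι) (i : Fin m) :
    affineSimplex v (stdSimplex.vertex i) = v i := by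
  refine DFunLike.ext _ _ fun j => ?_
  rw [affineSimplex_apply, Finset.sum_eq_single i]
  · change (stdSimplex.vertex i : stdSimplex ℝ (Fin m)).1 i * _ = _
    simp
  · intro k _ hk
    change (stdSimplex.vertex i : stdSimplex ℝ (Fin m)).1 k * _ = _
    simp [hk]
  · simp

lemma affineSimplex_comp_vertex {m : ℕ} (v : Fin m → stdSimplex ℝ ι) :
    affineSimplex v ∘ stdSimplex.vertex = v :=
  funext (affineSimplex_vertex v)

lemma affineSimplex_vertices {m : ℕ} (t : stdSimplex ℝ (Fin m)) :
    affineSimplex stdSimplex.vertex t = t := by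
  refine DFunLike.ext _ _ fun j => ?_
  rw [affineSimplex_apply, Finset.sum_eq_single j]
  · change _ * (stdSimplex.vertex j : stdSimplex ℝ (Fin m)).1 j = _
    simp
  · intro k _ hk
    change _ * (stdSimplex.vertex k : stdSimplex ℝ (Fin m)).1 j = _
    simp [hk.symm]
  · simp

lemma affineSimplex_vertex_comp {m n : ℕ} (f : Fin m → Fin n) (t : stdSimplex ℝ (Fin m)) :
    affineSimplex (stdSimplex.vertex ∘ f) t = stdSimplex.map f t := by
  classical
  refine DFunLike.ext _ _ fun j => ?_
  rw [affineSimplex_apply, stdSimplex.map_coe, FunOnFinite.linearMap_apply_apply, Finset.sum_filter]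
  refine Finset.sum_congr rfl fun i _ => ?_
  change _ * (stdSimplex.vertex (f i) : stdSimplex ℝ (Fin n)).1 j = _
  simp [Pi.single_apply, eq_comm]

/-- The barycenter of an affine simplex in a standard simplex. -/
noncomputable def simplexBarycenter (m : ℕ) (v : Fin (m + 1) → stdSimplex ℝ ι) : stdSimplex ℝ ι :=
  affineSimplex v stdSimplex.barycenter

lemma affineSimplex_simplexBarycenter {m n : ℕ} (v : Fin n → stdSimplex ℝ ι)
    (w : Fin (m + 1) → stdSimplex ℝ (Fin n)) :
    affineSimplex v (simplexBarycenter m w) = simplexBarycenter m (affineSimplex v ∘ w) :=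
  affineSimplex_affineSimplex v w _

lemma affineSimplex_mem_convex {m : ℕ} (v : Fin m → stdSimplex ℝ ι) (t : stdSimplex ℝ (Fin m))
    {s : Set (ι → ℝ)} (hs : Convex ℝ s) (hv : ∀ i, (v i : ι → ℝ) ∈ s) :
    (affineSimplex v t : ι → ℝ) ∈ s :=
  hs.sum_mem (fun i _ => t.2.1 i) t.2.2 fun i _ => hv i

lemma dist_affineSimplex_le {m : ℕ} (v : Fin m → stdSimplex ℝ ι) (t : stdSimplex ℝ (Fin m))
    (p : stdSimplex ℝ ι) {r : ℝ} (hv : ∀ i, dist (v i) p ≤ r) : dist (affineSimplex v t) p ≤ r :=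
  affineSimplex_mem_convex v t (convex_closedBall (p : ι → ℝ) r) hv

lemma dist_simplexBarycenter_le {m : ℕ} (v : Fin (m + 1) → stdSimplex ℝ ι) {D : ℝ}
    (hv : ∀ i j, dist (v i) (v j) ≤ D) (k : Fin (m + 1)) :
    dist (simplexBarycenter m v) (v k) ≤ (m : ℝ) / (m + 1) * D := by
  have hm : (0 : ℝ) < m + 1 := by positivity
  have h1 : ((simplexBarycenter m v : stdSimplex ℝ ι) : ι → ℝ) - v k =
      (m + 1 : ℝ)⁻¹ • ∑ i ∈ Finset.univ.erase k, ((v i : ι → ℝ) - v k) := by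
    have h2 : ∑ i ∈ Finset.univ.erase k, ((v i : ι → ℝ) - v k) =
        ∑ i, ((v i : ι → ℝ) - v k) := by
      rw [← Finset.add_sum_erase _ _ (Finset.mem_univ k), sub_self, zero_add]
    have h3 : ∀ i, (stdSimplex.barycenter : stdSimplex ℝ (Fin (m + 1))) i = (m + 1 : ℝ)⁻¹ := by
      intro i
      exact (stdSimplex.barycenter_apply (𝕜 := ℝ) i).trans (by simp)
    rw [h2, simplexBarycenter, affineSimplex_coe, Finset.sum_sub_distrib, smul_sub,
      Finset.smul_sum]
    simp only [h3, Finset.sum_const, Finset.card_univ, Fintype.card_fin]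
    congr 1
    rw [← Nat.cast_smul_eq_nsmul ℝ, smul_smul]
    push_cast
    rw [inv_mul_cancel₀ hm.ne', one_smul]
  rw [Subtype.dist_eq, dist_eq_norm]
  refine (congrArg norm h1).le.trans ?_
  rw [norm_smul, Real.norm_of_nonneg (by positivity),
    div_eq_inv_mul, mul_assoc]
  refine mul_le_mul_of_nonneg_left ((norm_sum_le _ _).trans ?_) (by positivity)
  refine (Finset.sum_le_card_nsmul _ _ D fun i _ => ?_).trans ?_
  · exact (dist_eq_norm (v i : ι → ℝ) (v k)).symm.le.trans (hv i k)
  · simp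

variable (K : Type v) [Field K]

/-- The tuples occurring in the subdivision of a tuple. -/
lemma tupleSd_single_mem_supported (m : ℕ) (v : Fin m → stdSimplex ℝ ι) {D : ℝ}
    (hv : ∀ i j, dist (v i) (v j) ≤ D) :
    tupleSd simplexBarycenter m (Finsupp.single v (1 : K)) ∈ Finsupp.supported K K
      {w : Fin m → stdSimplex ℝ ι | (∀ i, ∃ t, w i = affineSimplex v t) ∧
        ∀ i j, dist (w i) (w j) ≤ ((m - 1 : ℕ) : ℝ) / m * D} := by
  induction m with
  | zero => exact Finsupp.single_mem_supported K _ ⟨fun i => i.elim0, fun i => i.elim0⟩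
  | succ m ih =>
    rw [tupleSd_single]
    have hD : 0 ≤ D := dist_nonneg.trans (hv 0 0)
    have key : tupleSd simplexBarycenter m
        (tupleBoundary K (stdSimplex ℝ ι) m (Finsupp.single v (1 : K))) ∈ Finsupp.supported K K
        {w : Fin m → stdSimplex ℝ ι | (∀ i, ∃ t, w i = affineSimplex v t) ∧
        ∀ i j, dist (w i) (w j) ≤ (m : ℝ) / (m + 1) * D} := by
      rw [tupleBoundary_single, one_smul, map_sum]
      refine Submodule.sum_mem _ fun i _ => ?_
      rw [← Finsupp.smul_single_one, map_smul]
      refine Submodule.smul_mem _ _ (Finsupp.supported_mono ?_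
        (ih (v ∘ i.succAbove) fun _ _ => hv _ _))
      rintro w ⟨hw, hw'⟩
      refine ⟨fun j => ?_, fun j l => (hw' j l).trans ?_⟩
      · obtain ⟨t, ht⟩ := hw j
        refine ⟨affineSimplex (stdSimplex.vertex ∘ i.succAbove) t, ?_⟩
        rw [ht, affineSimplex_affineSimplex, ← Function.comp_assoc, affineSimplex_comp_vertex]
      · refine mul_le_mul_of_nonneg_right ?_ hD
        have hm : 0 < m := j.pos
        rw [div_le_div_iff₀ (by positivity) (by positivity), Nat.cast_pred hm]
        nlinarith
    refine map_mem_of_mem_supported (tupleCone K _ m) (fun w hw => ?_) key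
    rw [tupleCone_single]
    refine Finsupp.single_mem_supported K _ ⟨fun i => ?_, fun i j => ?_⟩
    · refine Fin.cases ⟨_, rfl⟩ (fun i => ?_) i
      simpa using hw.1 i
    · have hb : ∀ i, dist (simplexBarycenter m v) (w i) ≤ (m : ℝ) / (m + 1) * D := fun i => by
        obtain ⟨t, ht⟩ := hw.1 i
        rw [ht, dist_comm]
        refine dist_affineSimplex_le v t _ fun k => ?_
        rw [dist_comm]
        exact dist_simplexBarycenter_le v hv k
      rw [Nat.add_sub_cancel, Nat.cast_succ]
      refine Fin.cases (Fin.cases ?_ (fun j => ?_) j) (fun i => Fin.cases ?_ (fun j => ?_) j) i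
      · rw [dist_self]; positivity
      · simpa using hb j
      · simpa [dist_comm] using hb i
      · simpa using hw.2 i j

/-- Iterated subdivision makes the simplices of a chain of tuples arbitrarily small. -/
lemma exists_iterate_tupleSd_mem_supported (m : ℕ) (v : Fin m → stdSimplex ℝ ι) {ε : ℝ}
    (hε : 0 < ε) :
    ∃ k : ℕ, (tupleSd simplexBarycenter m)^[k] (Finsupp.single v (1 : K)) ∈
      Finsupp.supported K K {w : Fin m → stdSimplex ℝ ι | ∀ i j, dist (w i) (w j) < ε} := by
  set r : ℝ := ((m - 1 : ℕ) : ℝ) / m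
  obtain ⟨D, hD⟩ : ∃ D : ℝ, ∀ i j, dist (v i) (v j) ≤ D :=
    ⟨Metric.diam (Set.range v), fun i j => Metric.dist_le_diam_of_mem
      (Set.finite_range v).isBounded (Set.mem_range_self i) (Set.mem_range_self j)⟩
  have h : ∀ k : ℕ, (tupleSd simplexBarycenter m)^[k] (Finsupp.single v (1 : K)) ∈
      Finsupp.supported K K {w : Fin m → stdSimplex ℝ ι | ∀ i j, dist (w i) (w j) ≤ r ^ k * D} := by
    intro k
    induction k with
    | zero => exact Finsupp.single_mem_supported K _ (by simpa using hD)
    | succ k ih =>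
      rw [Function.iterate_succ_apply']
      refine map_mem_of_mem_supported (tupleSd simplexBarycenter m) (fun w hw => ?_) ih
      refine Finsupp.supported_mono ?_ (tupleSd_single_mem_supported K m w hw)
      rintro u ⟨-, hu⟩
      rw [pow_succ', Set.mem_ofPred_eq]
      simpa only [mul_assoc] using hu
  have hr : r < 1 := by
    rcases Nat.eq_zero_or_pos m with rfl | hm
    · simp [r]
    · rw [div_lt_one (by positivity)]
      exact_mod_cast Nat.sub_lt hm one_pos
  have hlim : Filter.Tendsto (fun k : ℕ => r ^ k * D) Filter.atTop (nhds 0) := by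
    simpa using (tendsto_pow_atTop_nhds_zero_of_lt_one (by positivity) hr).mul_const D
  obtain ⟨k, hk⟩ := (hlim.eventually_lt_const hε).exists
  exact ⟨k, Finsupp.supported_mono (fun w hw i j => (hw i j).trans_lt hk) (h k)⟩

end AffineSimplices

/-! ### Singular chains as formal linear combinations of singular simplices -/

section SingularChains

/-- The type of singular `n`-simplices of `X`. -/
abbrev SingSimplex (X : Type*) [TopologicalSpace X] (n : ℕ) := C(stdSimplex ℝ (Fin (n + 1)), X)

/-- The inclusion of the face opposite to the vertex `i`. -/
noncomputable def simplexFace {n : ℕ} (i : Fin (n + 2)) :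
    C(stdSimplex ℝ (Fin (n + 1)), stdSimplex ℝ (Fin (n + 2))) :=
  ⟨stdSimplex.map i.succAbove, stdSimplex.continuous_map _⟩

variable (K : Type v) [Field K] {X : Type u} [TopologicalSpace X]

/-- The boundary operator on singular chains. -/
noncomputable def singBoundary (X : Type u) [TopologicalSpace X] (n : ℕ) :
    (SingSimplex X (n + 1) →₀ K) →ₗ[K] (SingSimplex X n →₀ K) :=
  Finsupp.linearCombination K fun σ =>
    ∑ i : Fin (n + 2), Finsupp.single (σ.comp (simplexFace i)) ((-1 : K) ^ (i : ℕ))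

/-- The map from chains of tuples in a standard simplex to the singular chains of `X` induced by a
singular simplex of `X`. -/
noncomputable def realizeTuples {n : ℕ} (σ : SingSimplex X n) (m : ℕ) :
    ((Fin (m + 1) → stdSimplex ℝ (Fin (n + 1))) →₀ K) →ₗ[K] (SingSimplex X m →₀ K) :=
  Finsupp.lmapDomain K K fun w => σ.comp (affineSimplex w)

variable (X) in
/-- The barycentric subdivision of singular chains. -/
noncomputable def singSd (n : ℕ) : (SingSimplex X n →₀ K) →ₗ[K] (SingSimplex X n →₀ K) :=
  Finsupp.linearCombination K fun σ => realizeTuples K σ n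
    (tupleSd simplexBarycenter (n + 1) (Finsupp.single stdSimplex.vertex 1))

variable (X) in
/-- The chain homotopy between the identity and the barycentric subdivision. -/
noncomputable def singSdHomotopy (n : ℕ) :
    (SingSimplex X n →₀ K) →ₗ[K] (SingSimplex X (n + 1) →₀ K) :=
  Finsupp.linearCombination K fun σ => realizeTuples K σ (n + 1)
    (tupleSdHomotopy simplexBarycenter (n + 1) (Finsupp.single stdSimplex.vertex 1))

/-- The singular chains of `X` that lie in the subset `A`. -/
def singChainsIn (A : Set X) (n : ℕ) : Submodule K (SingSimplex X n →₀ K) :=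
  Finsupp.supported K K {σ | ∀ t, σ t ∈ A}

variable {K}

@[simp]
lemma singBoundary_single (n : ℕ) (σ : SingSimplex X (n + 1)) (a : K) :
    singBoundary K X n (Finsupp.single σ a) =
      a • ∑ i : Fin (n + 2), Finsupp.single (σ.comp (simplexFace i)) ((-1 : K) ^ (i : ℕ)) := by
  simp [singBoundary]

@[simp]
lemma realizeTuples_single {n : ℕ} (σ : SingSimplex X n) (m : ℕ)
    (w : Fin (m + 1) → stdSimplex ℝ (Fin (n + 1))) (a : K) :
    realizeTuples K σ m (Finsupp.single w a) = Finsupp.single (σ.comp (affineSimplex w)) a := by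
  simp [realizeTuples]

lemma realizeTuples_vertex {n : ℕ} (σ : SingSimplex X n) (a : K) :
    realizeTuples K σ n (Finsupp.single stdSimplex.vertex a) = Finsupp.single σ a := by
  rw [realizeTuples_single]
  congr 1
  ext t
  simp [affineSimplex_vertices]

lemma singSd_single (n : ℕ) (σ : SingSimplex X n) :
    singSd K X n (Finsupp.single σ 1) = realizeTuples K σ n
      (tupleSd simplexBarycenter (n + 1) (Finsupp.single stdSimplex.vertex 1)) := by
  simp [singSd]

lemma singSdHomotopy_single (n : ℕ) (σ : SingSimplex X n) :
    singSdHomotopy K X n (Finsupp.single σ 1) = realizeTuples K σ (n + 1)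
      (tupleSdHomotopy simplexBarycenter (n + 1) (Finsupp.single stdSimplex.vertex 1)) := by
  simp [singSdHomotopy]

lemma affineSimplex_comp_simplexFace {ι : Type*} [Fintype ι] {m : ℕ}
    (w : Fin (m + 2) → stdSimplex ℝ ι) (i : Fin (m + 2)) :
    (affineSimplex w).comp (simplexFace i) = affineSimplex (w ∘ i.succAbove) := by
  ext1 t
  change affineSimplex w (stdSimplex.map i.succAbove t) = _
  rw [← affineSimplex_vertex_comp, affineSimplex_affineSimplex, ← Function.comp_assoc,
    affineSimplex_comp_vertex]

lemma singBoundary_realizeTuples {n : ℕ} (σ : SingSimplex X n) (m : ℕ)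
    (c : (Fin (m + 2) → stdSimplex ℝ (Fin (n + 1))) →₀ K) :
    singBoundary K X m (realizeTuples K σ (m + 1) c) =
      realizeTuples K σ m (tupleBoundary K _ (m + 1) c) := by
  refine finsupp_linearMap_congr (f := singBoundary K X m ∘ₗ realizeTuples K σ (m + 1))
    (g := realizeTuples K σ m ∘ₗ tupleBoundary K _ (m + 1)) (fun w => ?_) c
  simp [ContinuousMap.comp_assoc, affineSimplex_comp_simplexFace]

lemma realizeTuples_comp_affineSimplex {n k : ℕ} (σ : SingSimplex X n)
    (w : Fin (k + 1) → stdSimplex ℝ (Fin (n + 1))) (m : ℕ)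
    (c : (Fin (m + 1) → stdSimplex ℝ (Fin (k + 1))) →₀ K) :
    realizeTuples K (σ.comp (affineSimplex w)) m c =
      realizeTuples K σ m (tupleMap K (affineSimplex w) (m + 1) c) := by
  refine finsupp_linearMap_congr (f := realizeTuples K (σ.comp (affineSimplex w)) m)
    (g := realizeTuples K σ m ∘ₗ tupleMap K (affineSimplex w) (m + 1)) (fun u => ?_) c
  simp only [realizeTuples_single, LinearMap.comp_apply, tupleMap_single]
  congr 1
  ext t
  simp [affineSimplex_affineSimplex]

lemma singSd_realizeTuples {n : ℕ} (σ : SingSimplex X n) (m : ℕ)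
    (c : (Fin (m + 1) → stdSimplex ℝ (Fin (n + 1))) →₀ K) :
    singSd K X m (realizeTuples K σ m c) =
      realizeTuples K σ m (tupleSd simplexBarycenter (m + 1) c) := by
  refine finsupp_linearMap_congr (f := singSd K X m ∘ₗ realizeTuples K σ m)
    (g := realizeTuples K σ m ∘ₗ tupleSd simplexBarycenter (m + 1)) (fun w => ?_) c
  rw [LinearMap.comp_apply, LinearMap.comp_apply, realizeTuples_single, singSd_single,
    realizeTuples_comp_affineSimplex,
    tupleMap_tupleSd fun m v => affineSimplex_simplexBarycenter w v, tupleMap_single,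
    affineSimplex_comp_vertex]

lemma singSdHomotopy_realizeTuples {n : ℕ} (σ : SingSimplex X n) (m : ℕ)
    (c : (Fin (m + 1) → stdSimplex ℝ (Fin (n + 1))) →₀ K) :
    singSdHomotopy K X m (realizeTuples K σ m c) =
      realizeTuples K σ (m + 1) (tupleSdHomotopy simplexBarycenter (m + 1) c) := by
  refine finsupp_linearMap_congr (f := singSdHomotopy K X m ∘ₗ realizeTuples K σ m)
    (g := realizeTuples K σ (m + 1) ∘ₗ tupleSdHomotopy simplexBarycenter (m + 1)) (fun w => ?_) c
  rw [LinearMap.comp_apply, LinearMap.comp_apply, realizeTuples_single, singSdHomotopy_single,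
    realizeTuples_comp_affineSimplex,
    tupleMap_tupleSdHomotopy fun m v => affineSimplex_simplexBarycenter w v, tupleMap_single,
    affineSimplex_comp_vertex]

lemma singBoundary_singSd (n : ℕ) (c : SingSimplex X (n + 1) →₀ K) :
    singBoundary K X n (singSd K X (n + 1) c) = singSd K X n (singBoundary K X n c) := by
  refine finsupp_linearMap_congr (f := singBoundary K X n ∘ₗ singSd K X (n + 1))
    (g := singSd K X n ∘ₗ singBoundary K X n) (fun σ => ?_) c
  rw [LinearMap.comp_apply, LinearMap.comp_apply, singSd_single, singBoundary_realizeTuples,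
    tupleBoundary_tupleSd, ← singSd_realizeTuples, ← singBoundary_realizeTuples,
    realizeTuples_vertex]

lemma singBoundary_singSdHomotopy_zero (c : SingSimplex X 0 →₀ K) :
    singBoundary K X 0 (singSdHomotopy K X 0 c) = c - singSd K X 0 c := by
  refine finsupp_linearMap_congr (f := singBoundary K X 0 ∘ₗ singSdHomotopy K X 0)
    (g := LinearMap.id - singSd K X 0) (fun σ => ?_) c
  rw [LinearMap.comp_apply, singSdHomotopy_single, singBoundary_realizeTuples,
    tupleBoundary_tupleSdHomotopy, tupleSdHomotopy_zero, sub_zero, map_sub, realizeTuples_vertex,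
    ← singSd_single]
  rfl

lemma singBoundary_singSdHomotopy (n : ℕ) (c : SingSimplex X (n + 1) →₀ K) :
    singBoundary K X (n + 1) (singSdHomotopy K X (n + 1) c) =
      c - singSd K X (n + 1) c - singSdHomotopy K X n (singBoundary K X n c) := by
  refine finsupp_linearMap_congr (f := singBoundary K X (n + 1) ∘ₗ singSdHomotopy K X (n + 1))
    (g := LinearMap.id - singSd K X (n + 1) - singSdHomotopy K X n ∘ₗ singBoundary K X n)
    (fun σ => ?_) c
  rw [LinearMap.comp_apply, singSdHomotopy_single, singBoundary_realizeTuples,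
    tupleBoundary_tupleSdHomotopy, map_sub, map_sub, realizeTuples_vertex, ← singSd_single,
    ← singSdHomotopy_realizeTuples, ← singBoundary_realizeTuples, realizeTuples_vertex]
  rfl

/-! ### Chains in subspaces -/

lemma singChainsIn_mono {A B : Set X} (h : A ⊆ B) (n : ℕ) :
    singChainsIn K A n ≤ singChainsIn K B n :=
  Finsupp.supported_mono fun _ hσ t => h (hσ t)

lemma singChainsIn_univ (n : ℕ) : singChainsIn K (Set.univ : Set X) n = ⊤ := by
  simp [singChainsIn]

lemma singChainsIn_inter (A B : Set X) (n : ℕ) :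
    singChainsIn K (A ∩ B) n = singChainsIn K A n ⊓ singChainsIn K B n := by
  rw [singChainsIn, singChainsIn, singChainsIn, ← Finsupp.supported_inter]
  congr 1
  ext σ
  exact forall_and

lemma realizeTuples_mem_singChainsIn {A : Set X} {n : ℕ} {σ : SingSimplex X n}
    (hσ : ∀ t, σ t ∈ A) (m : ℕ) (c : (Fin (m + 1) → stdSimplex ℝ (Fin (n + 1))) →₀ K) :
    realizeTuples K σ m c ∈ singChainsIn K A m := by
  refine map_mem_of_mem_supported (s := Set.univ) _ (fun w _ => ?_)
    (by rw [Finsupp.supported_univ]; trivial)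
  rw [realizeTuples_single]
  exact Finsupp.single_mem_supported K _ fun t => hσ _

lemma singBoundary_mem_singChainsIn {A : Set X} {n : ℕ} {c : SingSimplex X (n + 1) →₀ K}
    (hc : c ∈ singChainsIn K A (n + 1)) : singBoundary K X n c ∈ singChainsIn K A n := by
  refine map_mem_of_mem_supported _ (fun σ hσ => ?_) hc
  rw [singBoundary_single]
  exact Submodule.smul_mem _ _ (Submodule.sum_mem _ fun i _ =>
    Finsupp.single_mem_supported K _ fun t => hσ _)

lemma singSd_mem_singChainsIn {A : Set X} {n : ℕ} {c : SingSimplex X n →₀ K}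
    (hc : c ∈ singChainsIn K A n) : singSd K X n c ∈ singChainsIn K A n := by
  refine map_mem_of_mem_supported _ (fun σ hσ => ?_) hc
  rw [singSd_single]
  exact realizeTuples_mem_singChainsIn hσ _ _

lemma singSdHomotopy_mem_singChainsIn {A : Set X} {n : ℕ} {c : SingSimplex X n →₀ K}
    (hc : c ∈ singChainsIn K A n) : singSdHomotopy K X n c ∈ singChainsIn K A (n + 1) := by
  refine map_mem_of_mem_supported _ (fun σ hσ => ?_) hc
  rw [singSdHomotopy_single]
  exact realizeTuples_mem_singChainsIn hσ _ _

lemma iterate_singSd_mem_singChainsIn {A : Set X} {n : ℕ} {c : SingSimplex X n →₀ K}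
    (hc : c ∈ singChainsIn K A n) (k : ℕ) : (singSd K X n)^[k] c ∈ singChainsIn K A n := by
  induction k with
  | zero => exact hc
  | succ k ih => rw [Function.iterate_succ_apply']; exact singSd_mem_singChainsIn ih

lemma singBoundary_iterate_singSd (n k : ℕ) (c : SingSimplex X (n + 1) →₀ K) :
    singBoundary K X n ((singSd K X (n + 1))^[k] c) =
      (singSd K X n)^[k] (singBoundary K X n c) :=
  (Function.Semiconj.iterate_right (singBoundary_singSd n) k) c

/-- If the interiors of `A` and `B` cover `X`, then every singular chain of `X` becomes a sum of a
chain in `A` and a chain in `B` after sufficiently many barycentric subdivisions. -/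
theorem exists_iterate_singSd_mem_sup {A B : Set X} (h : interior A ∪ interior B = Set.univ)
    (n : ℕ) (c : SingSimplex X n →₀ K) :
    ∃ k : ℕ, (singSd K X n)^[k] c ∈ singChainsIn K A n ⊔ singChainsIn K B n := by
  have hsd : ∀ (k : ℕ) (c : SingSimplex X n →₀ K), c ∈ singChainsIn K A n ⊔ singChainsIn K B n →
      (singSd K X n)^[k] c ∈ singChainsIn K A n ⊔ singChainsIn K B n := by
    intro k c hc
    obtain ⟨a, ha, b, hb, rfl⟩ := Submodule.mem_sup.1 hc
    rw [← Module.End.coe_pow, map_add, Module.End.coe_pow]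
    exact Submodule.add_mem_sup (iterate_singSd_mem_singChainsIn ha k)
      (iterate_singSd_mem_singChainsIn hb k)
  induction c using Finsupp.induction_linear with
  | zero => exact ⟨0, Submodule.zero_mem _⟩
  | add c d hc hd =>
    obtain ⟨k, hk⟩ := hc
    obtain ⟨l, hl⟩ := hd
    refine ⟨k + l, ?_⟩
    rw [← Module.End.coe_pow, map_add, Module.End.coe_pow]
    refine Submodule.add_mem _ ?_ ?_
    · rw [add_comm, Function.iterate_add_apply]
      exact hsd _ _ hk
    · rw [Function.iterate_add_apply]
      exact hsd _ _ hl
  | single σ a =>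
    obtain ⟨ε, hε, hεσ⟩ := lebesgue_number_lemma_of_metric
      (s := (Set.univ : Set (stdSimplex ℝ (Fin (n + 1))))) isCompact_univ
      (c := fun b : Bool => σ ⁻¹' (bif b then interior A else interior B))
      (by rintro (_ | _) <;> exact isOpen_interior.preimage σ.continuous) (by
        intro t _
        rcases (h.symm ▸ Set.mem_univ (σ t) : σ t ∈ interior A ∪ interior B) with ht | ht
        · exact Set.mem_iUnion.2 ⟨true, ht⟩
        · exact Set.mem_iUnion.2 ⟨false, ht⟩)
    obtain ⟨k, hk⟩ := exists_iterate_tupleSd_mem_supported K (n + 1)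
      (stdSimplex.vertex (S := ℝ) (X := Fin (n + 1))) hε
    refine ⟨k, ?_⟩
    have hk' : (singSd K X n)^[k] (Finsupp.single σ 1) = realizeTuples K σ n
        ((tupleSd simplexBarycenter (n + 1))^[k] (Finsupp.single stdSimplex.vertex (1 : K))) := by
      rw [← realizeTuples_vertex σ]
      exact (Function.Semiconj.iterate_right
        (fun c => (singSd_realizeTuples σ n c).symm) k _).symm
    rw [← Finsupp.smul_single_one, ← Module.End.coe_pow, map_smul, Module.End.coe_pow, hk']
    refine Submodule.smul_mem _ _ (map_mem_of_mem_supported _ (fun w hw => ?_) hk)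
    rw [realizeTuples_single]
    obtain ⟨b, hb⟩ := hεσ (w 0) trivial
    have hw' : ∀ t, affineSimplex w t ∈ Metric.ball (w 0) ε := fun t =>
      affineSimplex_mem_convex w t (convex_ball (w 0 : Fin (n + 1) → ℝ) ε) fun i => hw i 0
    rcases b with _ | _
    · exact Submodule.mem_sup_right
        (Finsupp.single_mem_supported K _ fun t => interior_subset (hb (hw' t)))
    · exact Submodule.mem_sup_left
        (Finsupp.single_mem_supported K _ fun t => interior_subset (hb (hw' t)))

/-! ### Excision for chains -/

variable (K)

/-- The singular chains in `B` whose boundary lies in `A`. -/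
noncomputable def relCyclesIn (A B : Set X) : ∀ n : ℕ, Submodule K (SingSimplex X n →₀ K)
  | 0 => singChainsIn K B 0
  | n + 1 => singChainsIn K B (n + 1) ⊓ (singChainsIn K A n).comap (singBoundary K X n)

/-- The sums of boundaries of chains in `B` and chains in `A ∩ B`. -/
noncomputable def relBoundariesIn (A B : Set X) (n : ℕ) : Submodule K (SingSimplex X n →₀ K) :=
  (singChainsIn K B (n + 1)).map (singBoundary K X n) ⊔ singChainsIn K (A ∩ B) n

variable {K}

lemma relCyclesIn_le (A B : Set X) (n : ℕ) : relCyclesIn K A B n ≤ singChainsIn K B n := by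
  cases n
  · exact le_rfl
  · exact inf_le_left

lemma singSd_mem_relCyclesIn {A B : Set X} {n : ℕ} {c : SingSimplex X n →₀ K}
    (hc : c ∈ relCyclesIn K A B n) : singSd K X n c ∈ relCyclesIn K A B n := by
  cases n with
  | zero => exact singSd_mem_singChainsIn hc
  | succ n =>
    refine ⟨singSd_mem_singChainsIn hc.1, ?_⟩
    rw [SetLike.mem_coe, Submodule.mem_comap, singBoundary_singSd]
    exact singSd_mem_singChainsIn hc.2

lemma sub_singSd_mem_relBoundariesIn {A B : Set X} {n : ℕ} {c : SingSimplex X n →₀ K}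
    (hc : c ∈ relCyclesIn K A B n) : c - singSd K X n c ∈ relBoundariesIn K A B n := by
  cases n with
  | zero =>
    rw [← singBoundary_singSdHomotopy_zero]
    exact Submodule.mem_sup_left
      (Submodule.mem_map_of_mem (singSdHomotopy_mem_singChainsIn hc))
  | succ n =>
    rw [← sub_add_cancel (c - _) (singSdHomotopy K X n (singBoundary K X n c)),
      ← singBoundary_singSdHomotopy]
    refine Submodule.add_mem_sup
      (Submodule.mem_map_of_mem (singSdHomotopy_mem_singChainsIn hc.1))
      (singSdHomotopy_mem_singChainsIn ?_)
    rw [singChainsIn_inter]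
    exact ⟨hc.2, singBoundary_mem_singChainsIn hc.1⟩

lemma sub_iterate_singSd_mem_relBoundariesIn {A B : Set X} {n : ℕ} {c : SingSimplex X n →₀ K}
    (hc : c ∈ relCyclesIn K A B n) (k : ℕ) :
    c - (singSd K X n)^[k] c ∈ relBoundariesIn K A B n := by
  induction k generalizing c with
  | zero => simp
  | succ k ih =>
    rw [Function.iterate_succ_apply, ← sub_add_sub_cancel c (singSd K X n c)]
    exact add_mem (sub_singSd_mem_relBoundariesIn hc) (ih (singSd_mem_relCyclesIn hc))

lemma relCyclesIn_mono {A B E : Set X} (h : B ⊆ E) (n : ℕ) :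
    relCyclesIn K A B n ≤ relCyclesIn K A E n := by
  cases n
  · exact singChainsIn_mono h _
  · exact inf_le_inf_right _ (singChainsIn_mono h _)

lemma relBoundariesIn_mono {A B E : Set X} (h : B ⊆ E) (n : ℕ) :
    relBoundariesIn K A B n ≤ relBoundariesIn K A E n :=
  sup_le_sup (Submodule.map_mono (singChainsIn_mono h _))
    (singChainsIn_mono (Set.inter_subset_inter_right A h) _)

lemma singChainsIn_inf_sup_le (A B E : Set X) (n : ℕ) :
    singChainsIn K E n ⊓ (singChainsIn K A n ⊔ singChainsIn K B n) ≤
      singChainsIn K (A ∩ E) n ⊔ singChainsIn K (E ∩ B) n := by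
  simp only [singChainsIn, ← Finsupp.supported_union, ← Finsupp.supported_inter]
  refine Finsupp.supported_mono ?_
  rintro σ ⟨hE, hA | hB⟩
  · exact Or.inl fun t => ⟨hA t, hE t⟩
  · exact Or.inr fun t => ⟨hE t, hB t⟩

lemma exists_mem_relCyclesIn_sub_mem {A B : Set X} (h : interior A ∪ interior B = Set.univ)
    {E : Set X} {n : ℕ} {c : SingSimplex X n →₀ K} (hc : c ∈ relCyclesIn K A E n) :
    ∃ b ∈ relCyclesIn K A (E ∩ B) n, c - b ∈ relBoundariesIn K A E n := by
  obtain ⟨k, hk⟩ := exists_iterate_singSd_mem_sup h n c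
  obtain ⟨a, ha, b, hb, hab⟩ := Submodule.mem_sup.1 (singChainsIn_inf_sup_le A B E n
    ⟨iterate_singSd_mem_singChainsIn (relCyclesIn_le A E n hc) k, hk⟩)
  refine ⟨b, ?_, ?_⟩
  · cases n with
    | zero => exact hb
    | succ n =>
      refine ⟨hb, ?_⟩
      rw [SetLike.mem_coe, Submodule.mem_comap, ← add_sub_cancel_left a b, hab, map_sub,
        singBoundary_iterate_singSd]
      exact sub_mem (iterate_singSd_mem_singChainsIn hc.2 k)
        (singChainsIn_mono Set.inter_subset_left n (singBoundary_mem_singChainsIn ha))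
  · have : c - b = c - (singSd K X n)^[k] c + a := by rw [← hab]; abel
    rw [this]
    exact add_mem (sub_iterate_singSd_mem_relBoundariesIn hc k) (Submodule.mem_sup_right ha)

lemma mem_relBoundariesIn_of_mem_univ {A B : Set X} (h : interior A ∪ interior B = Set.univ)
    {n : ℕ} {c : SingSimplex X n →₀ K} (hc : c ∈ relCyclesIn K A B n)
    (hc' : c ∈ relBoundariesIn K A Set.univ n) : c ∈ relBoundariesIn K A B n := by
  obtain ⟨_, ⟨d, -, rfl⟩, e, he, rfl⟩ := Submodule.mem_sup.1 hc'
  rw [Set.inter_univ] at he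
  obtain ⟨k, hk⟩ := exists_iterate_singSd_mem_sup h (n + 1) d
  obtain ⟨a, ha, b, hb, hab⟩ := Submodule.mem_sup.1 hk
  rw [← sub_add_cancel (singBoundary K X n d + e)
    ((singSd K X n)^[k] (singBoundary K X n d + e))]
  refine add_mem (sub_iterate_singSd_mem_relBoundariesIn hc k) ?_
  have h1 : (singSd K X n)^[k] (singBoundary K X n d + e) - singBoundary K X n b =
      singBoundary K X n a + (singSd K X n)^[k] e := by
    rw [← Module.End.coe_pow, map_add, Module.End.coe_pow, ← singBoundary_iterate_singSd, ← hab,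
      map_add]
    abel
  rw [← add_sub_cancel (singBoundary K X n b) ((singSd K X n)^[k] (singBoundary K X n d + e))]
  refine Submodule.add_mem_sup (Submodule.mem_map_of_mem hb) ?_
  rw [singChainsIn_inter]
  refine ⟨?_, sub_mem (iterate_singSd_mem_singChainsIn (relCyclesIn_le A B n hc) k)
    (singBoundary_mem_singChainsIn hb)⟩
  rw [h1]
  exact add_mem (singBoundary_mem_singChainsIn ha) (iterate_singSd_mem_singChainsIn he k)

end SingularChains

section Subspaces

variable (K : Type v) [Field K] {X : Type u} [TopologicalSpace X] {Y : Type w} [TopologicalSpace Y]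

/-- The map on singular chains induced by a continuous map. -/
noncomputable def singMap (f : C(X, Y)) (n : ℕ) :
    (SingSimplex X n →₀ K) →ₗ[K] (SingSimplex Y n →₀ K) :=
  Finsupp.lmapDomain K K f.comp

variable {K}

@[simp]
lemma singMap_single (f : C(X, Y)) (n : ℕ) (σ : SingSimplex X n) (a : K) :
    singMap K f n (Finsupp.single σ a) = Finsupp.single (f.comp σ) a := by
  simp [singMap]

lemma singMap_singBoundary (f : C(X, Y)) (n : ℕ) (c : SingSimplex X (n + 1) →₀ K) :
    singMap K f n (singBoundary K X n c) = singBoundary K Y n (singMap K f (n + 1) c) := by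
  refine finsupp_linearMap_congr (f := singMap K f n ∘ₗ singBoundary K X n)
    (g := singBoundary K Y n ∘ₗ singMap K f (n + 1)) (fun σ => ?_) c
  simp [ContinuousMap.comp_assoc]

/-- The inclusion of a subspace. -/
abbrev subspaceIncl (S : Set X) : C(S, X) := ⟨Subtype.val, continuous_subtype_val⟩

variable (S : Set X)

lemma subspaceIncl_comp_injective (n : ℕ) :
    Function.Injective ((subspaceIncl S).comp : SingSimplex S n → SingSimplex X n) :=
  fun _ _ h => ContinuousMap.ext fun t => Subtype.ext (DFunLike.congr_fun h t)

lemma singMap_subspaceIncl_injective (n : ℕ) :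
    Function.Injective (singMap K (subspaceIncl S) n) :=
  Finsupp.mapDomain_injective (subspaceIncl_comp_injective S n)

variable {S}

lemma singMap_mem_singChainsIn_iff {A : Set X} {n : ℕ} {c : SingSimplex S n →₀ K} :
    singMap K (subspaceIncl S) n c ∈ singChainsIn K A n ↔
      c ∈ singChainsIn K (Subtype.val ⁻¹' A) n := by
  classical
  rw [singChainsIn, singChainsIn, Finsupp.mem_supported, Finsupp.mem_supported, singMap,
    Finsupp.lmapDomain_apply,
    Finsupp.mapDomain_support_of_injective (subspaceIncl_comp_injective S n), Finset.coe_image,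
    Set.image_subset_iff]
  rfl

lemma exists_singMap_eq {n : ℕ} {c : SingSimplex X n →₀ K} (hc : c ∈ singChainsIn K S n) :
    ∃ c' : SingSimplex S n →₀ K, singMap K (subspaceIncl S) n c' = c := by
  refine map_mem_of_mem_supported (f := LinearMap.id)
    (N := LinearMap.range (singMap K (subspaceIncl S) n)) (fun σ hσ => ?_) hc
  refine ⟨Finsupp.single ⟨fun t => ⟨σ t, hσ t⟩, σ.continuous.subtype_mk _⟩ 1, ?_⟩
  rw [singMap_single]
  rfl

lemma singMap_mem_relCyclesIn_iff {A E : Set X} {n : ℕ} {c : SingSimplex S n →₀ K} :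
    singMap K (subspaceIncl S) n c ∈ relCyclesIn K A E n ↔
      c ∈ relCyclesIn K (Subtype.val ⁻¹' A) (Subtype.val ⁻¹' E) n := by
  cases n with
  | zero => exact singMap_mem_singChainsIn_iff
  | succ n =>
    rw [relCyclesIn, relCyclesIn, Submodule.mem_inf, Submodule.mem_inf, Submodule.mem_comap,
      Submodule.mem_comap, ← singMap_singBoundary, singMap_mem_singChainsIn_iff,
      singMap_mem_singChainsIn_iff]

lemma mem_relBoundariesIn_of_singMap_mem {A : Set X} {n : ℕ} {c : SingSimplex S n →₀ K}
    (hc : singMap K (subspaceIncl S) n c ∈ relBoundariesIn K A S n) :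
    c ∈ relBoundariesIn K (Subtype.val ⁻¹' A) Set.univ n := by
  obtain ⟨_, ⟨d, hd, rfl⟩, e, he, h⟩ := Submodule.mem_sup.1 hc
  rw [singChainsIn_inter] at he
  obtain ⟨d, rfl⟩ := exists_singMap_eq hd
  obtain ⟨e, rfl⟩ := exists_singMap_eq he.2
  rw [← singMap_singBoundary, ← map_add] at h
  rw [← singMap_subspaceIncl_injective S n h]
  refine Submodule.add_mem_sup (Submodule.mem_map_of_mem ?_) ?_
  · rw [singChainsIn_univ]; trivial
  · rw [Set.inter_univ]
    exact singMap_mem_singChainsIn_iff.1 he.1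

end Subspaces

/-! ### Comparison with the singular chain complex -/

section Comparison

open Simplicial Opposite

variable (K : Type v) [Field K] (X : Type u) [TopologicalSpace X]


/-- The generator of the singular chain complex given by a singular simplex. -/
noncomputable def singGenerator {X : Type u} [TopologicalSpace X] {n : ℕ} (σ : SingSimplex X n) :
    ((singChains.{u, v} K).obj (TopCat.of X)).X n :=
  ((TopCat.toSSet.obj (TopCat.of X)).ιChainComplex (R := ModuleCat.of K (ULift.{u} K))
    ((TopCat.toSSetObjEquiv (TopCat.of X) (op ⦋n⦌)).symm σ)).hom (ULift.up (1 : K))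

/-- The map from formal linear combinations of singular simplices to the singular chain complex. -/
noncomputable def finsuppToSingChains (n : ℕ) :
    (SingSimplex X n →₀ K) →ₗ[K] ((singChains.{u, v} K).obj (TopCat.of X)).X n :=
  Finsupp.linearCombination K fun σ => singGenerator K σ

/-- The map from the singular chain complex to formal linear combinations of singular simplices. -/
noncomputable def singChainsToFinsupp (n : ℕ) :
    ((singChains.{u, v} K).obj (TopCat.of X)).X n ⟶
      ModuleCat.of.{max u v} K (SingSimplex X n →₀ K) :=
  (SSet.isColimitChainComplexXCofan (TopCat.toSSet.obj (TopCat.of X))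
    (ModuleCat.of K (ULift.{u} K)) n).desc (Cofan.mk _ fun σ =>
      ModuleCat.ofHom (Finsupp.lsingle (TopCat.toSSetObjEquiv (TopCat.of X) (op ⦋n⦌) σ) ∘ₗ
        ULift.moduleEquiv.toLinearMap))

lemma singChainsToFinsupp_ι (n : ℕ) (σ : (TopCat.toSSet.obj (TopCat.of X)) _⦋n⦌) (a : ULift.{u} K) :
    (singChainsToFinsupp K X n).hom (((TopCat.toSSet.obj (TopCat.of X)).ιChainComplex
      (R := ModuleCat.of K (ULift.{u} K)) σ).hom a) =
      Finsupp.single (TopCat.toSSetObjEquiv (TopCat.of X) (op ⦋n⦌) σ) a.down := by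
  have := (SSet.isColimitChainComplexXCofan (TopCat.toSSet.obj (TopCat.of X))
    (ModuleCat.of K (ULift.{u} K)) n).fac
    (Cofan.mk (ModuleCat.of.{max u v} K (SingSimplex X n →₀ K)) fun σ =>
      ModuleCat.ofHom (Finsupp.lsingle (TopCat.toSSetObjEquiv (TopCat.of X) (op ⦋n⦌) σ) ∘ₗ
        ULift.moduleEquiv.toLinearMap)) ⟨σ⟩
  exact congrArg (fun f => f.hom a) this

lemma finsuppToSingChains_single (n : ℕ) (σ : SingSimplex X n) (a : K) :
    finsuppToSingChains.{u, v} K X n (Finsupp.single σ a) = a • singGenerator K σ := by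
  simp [finsuppToSingChains]

lemma finsuppToSingChains_injective (n : ℕ) :
    Function.Injective (finsuppToSingChains.{u, v} K X n) := by
  refine Function.LeftInverse.injective (g := (singChainsToFinsupp K X n).hom) fun c => ?_
  refine finsupp_linearMap_congr (f := (singChainsToFinsupp K X n).hom ∘ₗ finsuppToSingChains K X n)
    (g := LinearMap.id) (fun σ => ?_) c
  rw [LinearMap.comp_apply, finsuppToSingChains_single, one_smul]
  exact (singChainsToFinsupp_ι K X n _ _).trans (by simp)

lemma finsuppToSingChains_surjective (n : ℕ) :
    Function.Surjective (finsuppToSingChains.{u, v} K X n) := by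
  refine Function.RightInverse.surjective (g := (singChainsToFinsupp K X n).hom) fun c => ?_
  have : singChainsToFinsupp K X n ≫ ModuleCat.ofHom (finsuppToSingChains.{u, v} K X n) = 𝟙 _ := by
    refine SSet.chainComplex_hom_ext fun σ => ?_
    ext a
    refine (congrArg (finsuppToSingChains.{u, v} K X n) (singChainsToFinsupp_ι K X n σ a)).trans ?_
    rw [finsuppToSingChains_single, singGenerator, Equiv.symm_apply_apply]
    exact (map_smul ((TopCat.toSSet.obj (TopCat.of X)).ιChainComplex
      (R := ModuleCat.of K (ULift.{u} K)) σ).hom a.down (ULift.up (1 : K))).symm.trans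
      (congrArg _ (ULift.ext _ _ (mul_one _)))
  exact congrArg (fun f => f.hom c) this

variable {X}

lemma singGenerator_d {n : ℕ} (σ : SingSimplex X (n + 1)) :
    (((singChains.{u, v} K).obj (TopCat.of X)).d (n + 1) n).hom (singGenerator K σ) =
      ∑ i : Fin (n + 2), (-1 : K) ^ (i : ℕ) • singGenerator K (σ.comp (simplexFace i)) := by
  have h := congrArg (fun f : ModuleCat.of K (ULift.{u} K) ⟶ _ => f.hom (ULift.up (1 : K)))
    (SSet.ιChainComplex_d (TopCat.toSSet.obj (TopCat.of X)) (ModuleCat.of K (ULift.{u} K))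
      ((TopCat.toSSetObjEquiv (TopCat.of X) (op ⦋n + 1⦌)).symm σ))
  refine h.trans ?_
  simp only [ModuleCat.hom_sum, LinearMap.sum_apply]
  refine Finset.sum_congr rfl fun i _ => ?_
  rw [ModuleCat.hom_zsmul, LinearMap.smul_apply, ← Int.cast_smul_eq_zsmul K]
  push_cast
  rfl

lemma finsuppToSingChains_singBoundary (n : ℕ) (c : SingSimplex X (n + 1) →₀ K) :
    finsuppToSingChains.{u, v} K X n (singBoundary K X n c) =
      (((singChains.{u, v} K).obj (TopCat.of X)).d (n + 1) n).hom
        (finsuppToSingChains.{u, v} K X (n + 1) c) := by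
  refine finsupp_linearMap_congr (f := finsuppToSingChains.{u, v} K X n ∘ₗ singBoundary K X n)
    (g := (((singChains.{u, v} K).obj (TopCat.of X)).d (n + 1) n).hom ∘ₗ
        finsuppToSingChains.{u, v} K X (n + 1)) (fun σ => ?_) c
  rw [LinearMap.comp_apply, LinearMap.comp_apply, finsuppToSingChains_single, one_smul,
    singGenerator_d, singBoundary_single, one_smul, map_sum]
  simp only [finsuppToSingChains_single]

variable {Y : Type u} [TopologicalSpace Y]

lemma singGenerator_map (f : C(X, Y)) {n : ℕ} (σ : SingSimplex X n) :
    (((singChains.{u, v} K).map (TopCat.ofHom f)).f n).hom (singGenerator K σ) =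
      singGenerator K (f.comp σ) :=
  congrArg (fun f : ModuleCat.of K (ULift.{u} K) ⟶ _ => f.hom (ULift.up (1 : K)))
    (SSet.ι_chainComplexMap_f _ _ (TopCat.toSSet.map (TopCat.ofHom f))
      (ModuleCat.of K (ULift.{u} K))
      ((TopCat.toSSetObjEquiv (TopCat.of X) (op ⦋n⦌)).symm σ))

lemma finsuppToSingChains_singMap (f : C(X, Y)) (n : ℕ) (c : SingSimplex X n →₀ K) :
    finsuppToSingChains.{u, v} K Y n (singMap K f n c) =
      (((singChains.{u, v} K).map (TopCat.ofHom f)).f n).hom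
        (finsuppToSingChains.{u, v} K X n c) := by
  refine finsupp_linearMap_congr (f := finsuppToSingChains.{u, v} K Y n ∘ₗ singMap K f n)
    (g := (((singChains.{u, v} K).map (TopCat.ofHom f)).f n).hom ∘ₗ
        finsuppToSingChains.{u, v} K X n) (fun σ => ?_) c
  rw [LinearMap.comp_apply, LinearMap.comp_apply, finsuppToSingChains_single, singMap_single,
    finsuppToSingChains_single, one_smul, one_smul, singGenerator_map]

end Comparison

/-! ### Homology classes of cycles -/

section HomologyClasses

variable {K : Type v} [Field K] {ι : Type*} {s : ComplexShape ι}

/-- The homology class `h` is represented by the chain `y`. -/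
def IsClassOf (Q : HomologicalComplex (ModuleCat.{w} K) s) {n : ι} (y : Q.X n)
    (h : Q.homology n) : Prop :=
  ∃ z : Q.cycles n, (Q.iCycles n).hom z = y ∧ (Q.homologyπ n).hom z = h

variable {Q : HomologicalComplex (ModuleCat.{w} K) s} {n : ι}

lemma exists_isClassOf (h : Q.homology n) : ∃ y, IsClassOf Q y h := by
  obtain ⟨z, hz⟩ := (ModuleCat.epi_iff_surjective (Q.homologyπ n)).1 inferInstance h
  exact ⟨_, z, rfl, hz⟩

lemma IsClassOf.d_eq_zero {y : Q.X n} {h : Q.homology n} (hy : IsClassOf Q y h) (j : ι) :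
    (Q.d n j).hom y = 0 := by
  obtain ⟨z, rfl, -⟩ := hy
  exact congrArg (fun f => f.hom z) (Q.iCycles_d n j)

lemma exists_isClassOf_of_d_eq_zero {y : Q.X n} (hy : (Q.d n (s.next n)).hom y = 0) :
    ∃ h, IsClassOf Q y h := by
  refine ⟨_, (Q.sc n).moduleCatCyclesIso.inv.hom ⟨y, hy⟩, ?_, rfl⟩
  exact congrArg (fun f => f.hom ⟨y, hy⟩) (Q.sc n).moduleCatCyclesIso_inv_iCycles

lemma iCycles_injective (Q : HomologicalComplex (ModuleCat.{w} K) s) (n : ι) :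
    Function.Injective (Q.iCycles n).hom :=
  (ModuleCat.mono_iff_injective (Q.iCycles n)).1 inferInstance

lemma IsClassOf.eq_zero_iff {y : Q.X n} {h : Q.homology n} (hy : IsClassOf Q y h) :
    h = 0 ↔ ∃ x, (Q.d (s.prev n) n).hom x = y := by
  obtain ⟨z, rfl, rfl⟩ := hy
  have hex : (ShortComplex.mk (Q.toCycles (s.prev n) n) (Q.homologyπ n) (by simp)).Exact :=
    ShortComplex.exact_of_g_is_cokernel _ (Q.homologyIsCokernel _ n rfl)
  constructor
  · intro hz
    obtain ⟨x, rfl⟩ := (ShortComplex.moduleCat_exact_iff _).1 hex z hz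
    exact ⟨x, (congrArg (fun f => f.hom x) (Q.toCycles_i (s.prev n) n)).symm⟩
  · rintro ⟨x, hx⟩
    have : (Q.toCycles (s.prev n) n).hom x = z := iCycles_injective Q n
      ((congrArg (fun f => f.hom x) (Q.toCycles_i (s.prev n) n)).trans hx)
    rw [← this]
    exact congrArg (fun f => f.hom x) (Q.toCycles_comp_homologyπ (s.prev n) n)

lemma IsClassOf.map {Q' : HomologicalComplex (ModuleCat.{w} K) s} {y : Q.X n} {h : Q.homology n}
    (hy : IsClassOf Q y h) (f : Q ⟶ Q') :
    IsClassOf Q' ((f.f n).hom y) ((HomologicalComplex.homologyMap f n).hom h) := by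
  obtain ⟨z, rfl, rfl⟩ := hy
  refine ⟨(HomologicalComplex.cyclesMap f n).hom z, ?_, ?_⟩
  · exact congrArg (fun f => f.hom z) (HomologicalComplex.cyclesMap_i f n)
  · exact (congrArg (fun f => f.hom z) (HomologicalComplex.homologyπ_naturality f n)).symm

lemma IsClassOf.sub {y y' : Q.X n} {h h' : Q.homology n} (hy : IsClassOf Q y h)
    (hy' : IsClassOf Q y' h') : IsClassOf Q (y - y') (h - h') := by
  obtain ⟨z, rfl, rfl⟩ := hy
  obtain ⟨z', rfl, rfl⟩ := hy'
  exact ⟨z - z', map_sub _ _ _, map_sub _ _ _⟩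

end HomologyClasses

section Cokernel

variable {K : Type v} [Field K] {ι : Type*} {s : ComplexShape ι}
  {Q Q' : HomologicalComplex (ModuleCat.{w} K) s} (i : Q ⟶ Q') (n : ι)

lemma cokernel_π_f_surjective : Function.Surjective ((cokernel.π i).f n).hom :=
  (ModuleCat.epi_iff_surjective _).1 inferInstance

lemma cokernel_π_f_eq_zero_iff (y : Q'.X n) :
    ((cokernel.π i).f n).hom y = 0 ↔ ∃ x, (i.f n).hom x = y := by
  have h := (ShortComplex.exact_cokernel i).map (HomologicalComplex.eval _ _ n)
  constructor
  · exact (ShortComplex.moduleCat_exact_iff _).1 h y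
  · rintro ⟨x, rfl⟩
    exact ShortComplex.moduleCat_zero_apply
      ((ShortComplex.mk i (cokernel.π i) (by simp)).map (HomologicalComplex.eval _ _ n)) x

end Cokernel

/-! ### Relative singular homology classes -/

section RelativeClasses

variable {K : Type v} [Field K] {X : Type u} [TopologicalSpace X]

/-- The projection from singular chains of `X` to relative singular chains of `(X, A)`. -/
noncomputable def toRelSingChains (K : Type v) [Field K] (A : Set X) (n : ℕ) :
    (SingSimplex X n →₀ K) →ₗ[K] ((relSingChains.{u, v} K).obj (topPair A)).X n :=
  ((cokernel.π ((singChains.{u, v} K).map (topPair A).map)).f n).hom ∘ₗ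
    finsuppToSingChains.{u, v} K X n

lemma toRelSingChains_surjective (A : Set X) (n : ℕ) :
    Function.Surjective (toRelSingChains.{u, v} K A n) :=
  (cokernel_π_f_surjective ((singChains.{u, v} K).map (topPair A).map) n).comp
    (finsuppToSingChains_surjective K X n)

lemma toRelSingChains_eq_zero_iff {A : Set X} {n : ℕ} {c : SingSimplex X n →₀ K} :
    toRelSingChains.{u, v} K A n c = 0 ↔ c ∈ singChainsIn K A n := by
  refine (cokernel_π_f_eq_zero_iff ((singChains.{u, v} K).map (topPair A).map) n _).trans ?_
  constructor
  · rintro ⟨x, hx⟩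
    obtain ⟨c', rfl⟩ := finsuppToSingChains_surjective K A n x
    have h := (finsuppToSingChains_singMap K (subspaceIncl A) n c').trans hx
    rw [← finsuppToSingChains_injective K X n h, singMap_mem_singChainsIn_iff,
      Subtype.coe_preimage_self, singChainsIn_univ]
    trivial
  · intro hc
    obtain ⟨c', rfl⟩ := exists_singMap_eq hc
    exact ⟨_, (finsuppToSingChains_singMap K (subspaceIncl A) n c').symm⟩

lemma toRelSingChains_d {A : Set X} {n : ℕ} (c : SingSimplex X (n + 1) →₀ K) :
    (((relSingChains.{u, v} K).obj (topPair A)).d (n + 1) n).hom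
      (toRelSingChains.{u, v} K A (n + 1) c) =
    toRelSingChains.{u, v} K A n (singBoundary K X n c) := by
  refine Eq.trans ?_ (congrArg
    ((cokernel.π ((singChains.{u, v} K).map (topPair A).map)).f n).hom
    (finsuppToSingChains_singBoundary K n c).symm)
  exact congrArg (fun f => f.hom (finsuppToSingChains.{u, v} K X (n + 1) c))
    ((cokernel.π ((singChains.{u, v} K).map (topPair A).map)).comm (n + 1) n)

lemma toRelSingChains_map {A S : Set X} {T : Set S} (h : Set.MapsTo Subtype.val T A) {n : ℕ}
    (c : SingSimplex S n →₀ K) :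
    (((relSingChains.{u, v} K).map (inclPair A S T h)).f n).hom
      (toRelSingChains.{u, v} K T n c) =
    toRelSingChains.{u, v} K A n (singMap K (subspaceIncl S) n c) := by
  refine Eq.trans ?_ (congrArg
    ((cokernel.π ((singChains.{u, v} K).map (topPair A).map)).f n).hom
    (finsuppToSingChains_singMap K (subspaceIncl S) n c).symm)
  have := (coker.π (C := ChainComplex (ModuleCat.{max u v} K) ℕ)).naturality
    ((singChains.{u, v} K).mapArrow.map ((MorphismProperty.Arrow.forget _ _ _).map
      (inclPair A S T h)))
  exact (congrArg (fun f => (f.f n).hom (finsuppToSingChains.{u, v} K S n c)) this).symm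

/-- The relative homology class `h` is represented by the singular chain `c`. -/
def IsRelClass (A : Set X) {n : ℕ} (c : SingSimplex X n →₀ K)
    (h : (relHomology.{u, v} K n).obj (topPair A)) : Prop :=
  IsClassOf ((relSingChains.{u, v} K).obj (topPair A)) (toRelSingChains.{u, v} K A n c) h

variable {A : Set X} {n : ℕ}

lemma mem_relCyclesIn_univ_iff {c : SingSimplex X n →₀ K} :
    c ∈ relCyclesIn K A Set.univ n ↔
    (((relSingChains.{u, v} K).obj (topPair A)).d n ((ComplexShape.down ℕ).next n)).hom
      (toRelSingChains.{u, v} K A n c) = 0 := by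
  cases n with
  | zero =>
    rw [HomologicalComplex.shape _ _ _ (by simp)]
    rw [relCyclesIn, singChainsIn_univ]
    simp
  | succ n =>
    have : (ComplexShape.down ℕ).next (n + 1) = n := by simp
    rw [this, toRelSingChains_d, toRelSingChains_eq_zero_iff, relCyclesIn, singChainsIn_univ]
    simp

lemma exists_isRelClass (h : (relHomology.{u, v} K n).obj (topPair A)) :
    ∃ c ∈ relCyclesIn K A Set.univ n, IsRelClass A c h := by
  obtain ⟨y, hy⟩ := exists_isClassOf (Q := (relSingChains.{u, v} K).obj (topPair A)) h
  obtain ⟨c, rfl⟩ := toRelSingChains_surjective A n y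
  exact ⟨c, mem_relCyclesIn_univ_iff.2 (hy.d_eq_zero _), hy⟩

lemma exists_isRelClass_of_mem {c : SingSimplex X n →₀ K}
    (hc : c ∈ relCyclesIn K A Set.univ n) :
    ∃ h : (relHomology.{u, v} K n).obj (topPair A), IsRelClass A c h :=
  exists_isClassOf_of_d_eq_zero (mem_relCyclesIn_univ_iff.1 hc)

lemma IsRelClass.eq_zero_iff {c : SingSimplex X n →₀ K}
    {h : (relHomology.{u, v} K n).obj (topPair A)} (hc : IsRelClass A c h) :
    h = 0 ↔ c ∈ relBoundariesIn K A Set.univ n := by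
  refine (IsClassOf.eq_zero_iff hc).trans ?_
  have : (ComplexShape.down ℕ).prev n = n + 1 := by simp
  rw [this, relBoundariesIn, Set.inter_univ, singChainsIn_univ, Submodule.map_top,
    Submodule.mem_sup]
  constructor
  · rintro ⟨x, hx⟩
    obtain ⟨d, rfl⟩ := toRelSingChains_surjective A (n + 1) x
    rw [toRelSingChains_d, ← sub_eq_zero, ← neg_eq_zero, neg_sub, ← map_sub,
      toRelSingChains_eq_zero_iff] at hx
    exact ⟨_, ⟨d, rfl⟩, _, hx, add_sub_cancel _ _⟩
  · rintro ⟨_, ⟨d, rfl⟩, e, he, rfl⟩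
    refine ⟨toRelSingChains K A (n + 1) d, ?_⟩
    rw [toRelSingChains_d, map_add, toRelSingChains_eq_zero_iff.2 he, add_zero]

lemma IsRelClass.map {S : Set X} {T : Set S} {c : SingSimplex S n →₀ K}
    {γ : (relHomology.{u, v} K n).obj (topPair T)} (hc : IsRelClass T c γ)
    (h : Set.MapsTo Subtype.val T A) :
    IsRelClass A (singMap K (subspaceIncl S) n c)
      ((relHomology.{u, v} K n).map (inclPair A S T h) γ) := by
  have := IsClassOf.map hc ((relSingChains.{u, v} K).map (inclPair A S T h))
  rwa [toRelSingChains_map] at this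

lemma IsRelClass.sub {c c' : SingSimplex X n →₀ K}
    {h h' : (relHomology.{u, v} K n).obj (topPair A)} (hc : IsRelClass A c h)
    (hc' : IsRelClass A c' h') : IsRelClass A (c - c') (h - h') := by
  rw [IsRelClass, map_sub]
  exact IsClassOf.sub hc hc'

lemma IsRelClass.eq_of_sub_mem {c c' : SingSimplex X n →₀ K}
    {h h' : (relHomology.{u, v} K n).obj (topPair A)} (hc : IsRelClass A c h)
    (hc' : IsRelClass A c' h') (hcc' : c - c' ∈ relBoundariesIn K A Set.univ n) : h = h' :=
  sub_eq_zero.1 ((hc.sub hc').eq_zero_iff.2 hcc')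

end RelativeClasses

/-! ### Excision -/

section Excision

variable {K : Type v} [Field K] {X : Type u} [TopologicalSpace X]

lemma isSupportedIn_iff {A E : Set X} {n : ℕ} {α : (relHomology.{u, v} K n).obj (topPair A)} :
    IsSupportedIn K A E (k := n) α ↔ ∃ c ∈ relCyclesIn K A E n, IsRelClass A c α := by
  constructor
  · rintro ⟨γ, rfl⟩
    obtain ⟨c, hc, hγ⟩ := exists_isRelClass γ
    refine ⟨_, singMap_mem_relCyclesIn_iff.2 ?_, hγ.map (Set.mapsTo_preimage _ _)⟩
    rwa [Subtype.coe_preimage_self]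
  · rintro ⟨c, hc, hα⟩
    obtain ⟨c, rfl⟩ := exists_singMap_eq (relCyclesIn_le A E n hc)
    rw [singMap_mem_relCyclesIn_iff, Subtype.coe_preimage_self] at hc
    obtain ⟨γ, hγ⟩ := exists_isRelClass_of_mem hc
    refine ⟨γ, (hγ.map (Set.mapsTo_preimage _ _)).eq_of_sub_mem hα ?_⟩
    rw [sub_self]
    exact zero_mem _

instance subsingleton_relHomology_negSucc (n : ℕ) (P : TopPair.{u}) :
    Subsingleton ((relHomology.{u, v} K (Int.negSucc n)).obj P) :=
  inferInstanceAs (Subsingleton PUnit)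

variable {A B : Set X}

/-- Excision: if the interiors of `A` and `B` cover `X`, then the inclusion of `(B, A ∩ B)` into
`(X, A)` induces injective maps in relative singular homology. -/
theorem relHomology_map_inclPair_injective (h : interior A ∪ interior B = Set.univ) (k : ℤ) :
    Function.Injective ((relHomology.{u, v} K k).map
      (inclPair A B (Subtype.val ⁻¹' A) (Set.mapsTo_preimage _ _))) := by
  rcases k with n | n
  · refine (injective_iff_map_eq_zero _).2 fun γ hγ => ?_
    obtain ⟨c, hc, hcγ⟩ := exists_isRelClass (n := n) γ
    have h0 := (hcγ.map (Set.mapsTo_preimage _ _)).eq_zero_iff.1 hγ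
    refine hcγ.eq_zero_iff.2 (mem_relBoundariesIn_of_singMap_mem
      (mem_relBoundariesIn_of_mem_univ h (singMap_mem_relCyclesIn_iff.2 ?_) h0))
    rwa [Subtype.coe_preimage_self]
  · exact Function.injective_of_subsingleton _

/-- A homology class of `(X, A)` that is supported in `E` is the image of a homology class of
`(B, A ∩ B)` that is supported in `E ∩ B`, if the interiors of `A` and `B` cover `X`. -/
theorem exists_isSupportedIn_map_inclPair_eq (h : interior A ∪ interior B = Set.univ) {k : ℤ}
    {E : Set X} {α : (relHomology.{u, v} K k).obj (topPair A)} (hα : IsSupportedIn K A E α) :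
    ∃ γ : (relHomology.{u, v} K k).obj (topPair (Subtype.val ⁻¹' A : Set B)),
      IsSupportedIn K _ (Subtype.val ⁻¹' E) γ ∧ (relHomology.{u, v} K k).map
        (inclPair A B (Subtype.val ⁻¹' A) (Set.mapsTo_preimage _ _)) γ = α := by
  rcases k with n | n
  · obtain ⟨c, hc, hcα⟩ := isSupportedIn_iff.1 hα
    obtain ⟨b, hb, hcb⟩ := exists_mem_relCyclesIn_sub_mem h hc
    obtain ⟨b, rfl⟩ := exists_singMap_eq
      (singChainsIn_mono Set.inter_subset_right n (relCyclesIn_le _ _ _ hb))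
    rw [singMap_mem_relCyclesIn_iff, Set.preimage_inter, Subtype.coe_preimage_self,
      Set.inter_univ] at hb
    have hb' : b ∈ relCyclesIn K (Subtype.val ⁻¹' A : Set B) Set.univ n :=
      relCyclesIn_mono (Set.subset_univ _) n hb
    obtain ⟨γ, hγ⟩ := exists_isRelClass_of_mem hb'
    exact ⟨γ, isSupportedIn_iff.2 ⟨b, hb, hγ⟩, (hcα.eq_of_sub_mem (hγ.map
      (Set.mapsTo_preimage _ _)) (relBoundariesIn_mono (Set.subset_univ _) n hcb)).symm⟩
  · exact ⟨0, ⟨0, Subsingleton.elim _ _⟩, Subsingleton.elim _ _⟩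

/-- Excision: if the interiors of `A` and `B` cover `X`, then the inclusion of `(B, A ∩ B)` into
`(X, A)` induces surjective maps in relative singular homology. -/
theorem relHomology_map_inclPair_surjective (h : interior A ∪ interior B = Set.univ) (k : ℤ) :
    Function.Surjective ((relHomology.{u, v} K k).map
      (inclPair A B (Subtype.val ⁻¹' A) (Set.mapsTo_preimage _ _))) := by
  intro α
  have hα : IsSupportedIn K A Set.univ α := by
    rcases k with n | n
    · exact isSupportedIn_iff.2 (exists_isRelClass α)
    · exact ⟨0, Subsingleton.elim _ _⟩
  obtain ⟨γ, -, hγ⟩ := exists_isSupportedIn_map_inclPair_eq h hα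
  exact ⟨γ, hγ⟩

/-- The image of a class supported in `E ⊆ B` is supported in `E`. -/
lemma IsSupportedIn.map_inclPair {k : ℤ} {E : Set B}
    {γ : (relHomology.{u, v} K k).obj (topPair (Subtype.val ⁻¹' A : Set B))}
    (hγ : IsSupportedIn K _ E γ) :
    IsSupportedIn K A (Subtype.val '' E) ((relHomology.{u, v} K k).map
        (inclPair A B (Subtype.val ⁻¹' A) (Set.mapsTo_preimage _ _)) γ) := by
  rcases k with n | n
  · obtain ⟨c, hc, hcγ⟩ := isSupportedIn_iff.1 hγ
    refine isSupportedIn_iff.2 ⟨_, singMap_mem_relCyclesIn_iff.2 ?_,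
      hcγ.map (Set.mapsTo_preimage _ _)⟩
    rwa [Set.preimage_image_eq _ Subtype.val_injective]
  · exact ⟨0, Subsingleton.elim _ _⟩

end Excision

/-! ### Transport of bilinear relations -/

section Transport

variable {K : Type v} [Field K] {V W : ℤ → ModuleCat.{w} K}

/-- The map on tensor squares induced by a map of graded vector spaces. -/
noncomputable def tensorSquareMap (f : ∀ k, V k ⟶ W k) (n : ℤ) :
    tensorSquare V n →ₗ[K] tensorSquare W n :=
  DirectSum.lmap fun p => TensorProduct.map (f p.1.1).hom (f p.1.2).hom

lemma tensorSquareMap_homogeneousTmul (f : ∀ k, V k ⟶ W k) {i j : ℤ} (x : V i) (y : V j) :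
    tensorSquareMap f (i + j) (homogeneousTmul V x y) =
      homogeneousTmul W ((f i).hom x) ((f j).hom y) := by
  rw [homogeneousTmul, tensorSquareMap, DirectSum.lmap_lof, TensorProduct.map_tmul]
  rfl

/-- The preimage of a bilinear relation is bilinear. -/
lemma IsBilinearRel.comap {r : GradedRel W} (hr : IsBilinearRel r) (f : ∀ k, V k ⟶ W k) :
    IsBilinearRel fun a b : Σ k, V k => r ⟨a.1, (f a.1).hom a.2⟩ ⟨b.1, (f b.1).hom b.2⟩ := by
  obtain ⟨R, hR⟩ := hr
  refine ⟨fun n => (R n).comap (tensorSquareMap f n), fun i j x y => ?_⟩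
  rw [Submodule.mem_comap, tensorSquareMap_homogeneousTmul]
  exact hR i j _ _

/-- A map that preserves generating relations preserves the generated bilinear relations. -/
lemma generatedRel_map {r : GradedRel V} {s : GradedRel W} (f : ∀ k, V k ⟶ W k)
    (h : ∀ (i j : ℤ) (x : V i) (y : V j), r ⟨i, x⟩ ⟨j, y⟩ →
      s ⟨i, (f i).hom x⟩ ⟨j, (f j).hom y⟩)
    {i j : ℤ} {x : V i} {y : V j} (hxy : generatedRel r ⟨i, x⟩ ⟨j, y⟩) :
    generatedRel s ⟨i, (f i).hom x⟩ ⟨j, (f j).hom y⟩ :=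
  generatedRel_le ((isBilinearRel_generatedRel s).comap f)
    (fun c d hcd => le_generatedRel s _ _ (h c.1 d.1 c.2 d.2 hcd)) _ _ hxy

end Transport

theorem mainTheorem2 {K : Type v} [Field K] {X : Type u} [TopologicalSpace X] [Preorder X]
    (A U : Set X) (hUA : U ⊆ A) (hU : closure U ⊆ interior A) :
    ∃ e : homologyDigraph K (X := ↥Uᶜ) (Subtype.val ⁻¹' (A \ U)) ≅ homologyDigraph K A,
      ∀ k : ℤ, e.hom.app k = (relHomology.{u, v} K k).map
        (inclPair A Uᶜ (Subtype.val ⁻¹' (A \ U)) (fun _ hx => hx.1)) := by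
  have hcov : interior A ∪ interior Uᶜ = Set.univ := by
    rw [interior_compl, ← Set.univ_subset_iff]
    intro x _
    by_cases hx : x ∈ closure U
    exacts [Or.inl (hU hx), Or.inr hx]
  have key : ∀ (T : Set ↥Uᶜ) (hT : T = Subtype.val ⁻¹' A) (hm : Set.MapsTo Subtype.val T A),
      ∃ e : homologyDigraph K T ≅ homologyDigraph K A,
        ∀ k : ℤ, e.hom.app k = (relHomology.{u, v} K k).map (inclPair A Uᶜ T hm) := by
    rintro _ rfl hm
    let f : ∀ k : ℤ, (relHomology.{u, v} K k).obj (topPair (Subtype.val ⁻¹' A : Set ↥Uᶜ)) ⟶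
        (relHomology.{u, v} K k).obj (topPair A) := fun k =>
      (relHomology.{u, v} K k).map (inclPair A Uᶜ _ hm)
    have hinj : ∀ k, Function.Injective (f k) := relHomology_map_inclPair_injective hcov
    have hiso : ∀ k, IsIso (f k) := fun k => (ConcreteCategory.isIso_iff_bijective _).2
      ⟨hinj k, relHomology_map_inclPair_surjective hcov k⟩
    choose g hfg hgf using fun k => (hiso k).out
    have hg : ∀ k z, (g k).hom ((f k).hom z) = z := fun k z =>
      congrArg (fun φ => φ.hom z) (hfg k)
    have hf : ∀ (i j : ℤ) x y, generatingRel K (Subtype.val ⁻¹' A : Set ↥Uᶜ) ⟨i, x⟩ ⟨j, y⟩ →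
        generatingRel K A ⟨i, (f i).hom x⟩ ⟨j, (f j).hom y⟩ := by
      rintro i j x y ⟨E, F, hE, hF, hEF⟩
      refine ⟨_, _, IsSupportedIn.map_inclPair hE, IsSupportedIn.map_inclPair hF, ?_⟩
      rintro _ ⟨x, hx, rfl⟩ _ ⟨y, hy, rfl⟩
      exact hEF x hx y hy
    have hg' : ∀ (i j : ℤ) x y, generatingRel K A ⟨i, x⟩ ⟨j, y⟩ →
        generatingRel K (Subtype.val ⁻¹' A : Set ↥Uᶜ) ⟨i, (g i).hom x⟩ ⟨j, (g j).hom y⟩ := by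
      rintro i j x y ⟨E, F, hE, hF, hEF⟩
      obtain ⟨γ, hγ, hx⟩ := exists_isSupportedIn_map_inclPair_eq hcov hE
      obtain ⟨δ, hδ, hy⟩ := exists_isSupportedIn_map_inclPair_eq hcov hF
      have hx' : (g i).hom x = γ := (congrArg (g i).hom hx.symm).trans (hg i γ)
      have hy' : (g j).hom y = δ := (congrArg (g j).hom hy.symm).trans (hg j δ)
      rw [hx', hy']
      exact ⟨_, _, hγ, hδ, fun x hx y hy => hEF x hx y hy⟩
    let e : homologyDigraph K (Subtype.val ⁻¹' A : Set ↥Uᶜ) ≅ homologyDigraph K A :=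
      { hom := ⟨f, fun _ _ _ _ => generatedRel_map f hf⟩
        inv := ⟨g, fun _ _ _ _ => generatedRel_map g hg'⟩
        hom_inv_id := DirGrVect.Hom.ext (funext hfg)
        inv_hom_id := DirGrVect.Hom.ext (funext hgf) }
    exact ⟨e, fun k => rfl⟩
  refine key _ ?_ _
  ext x
  exact ⟨fun hx => hx.1, fun hx => ⟨hx, x.2⟩⟩
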